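/- Let $\mathbb H_+=\{\zeta\in\mathbb C:\operatorname{Im}\zeta>0\}$ and let $H^2=H^2(\mathbb H_+)$ be the space of analytic functions $f$ on $\mathbb H_+$ with $\sup_{y>0}\|f(\cdot+iy)\|_{L^2(\mathbb R)}<\infty$. The boundary function of $f\in H^2$, again denoted by $f$, is the limit of $f(\cdot+ih)$ in $L^2(\mathbb R)$ as $h\downarrow 0$, and $\|f\|_{H^2}:=\|f\|_{L^2(\mathbb R)}$. All functions are complex valued. Theorem. Let $z\in\mathbb H_+$ and $\epsilon>0$. There is exactly one (up to null sets) $u=u_{\epsilon,z}\in L^2(-1,1)$ that solves $$\tfrac12\,(Ku+u)+\epsilon^2u=p_z\quad\text{a.e. on }(-1,1),\qquad Ku(x)=\frac{i}{\pi}\,\mathrm{p.v.}\!\int_{-1}^{1}\frac{u(y)}{x-y}\,dy,\qquad p_z(\zeta)=\frac{i}{\zeta-\overline z},$$ where the existence of the principal value for a.e. $x\in(-1,1)$ is part of the meaning of the equation. Extend $u$ to $\mathbb H_+$ by $$\epsilon^2u(\zeta)=p_z(\zeta)-\frac{i}{2\pi}\int_{-1}^{1}\frac{u(y)}{\zeta-y}\,dy,\qquad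 \zeta\in\mathbb H_+ .$$ Then $\|u\|_{L^2(-1,1)}>0$, the number $u(z)$ is real, and every $f\in H^2$ with $\|f\|_{H^2}\le 1$ and $\|f\|_{L^2(-1,1)}\le\epsilon$ satisfies $$|f(z)|\le\frac32\,\epsilon\,\frac{u_{\epsilon,z}(z)}{\|u_{\epsilon,z}\|_{L^2(-1,1)}} .$$ -/

import Mathlib

open MeasureTheory Filter Topology

/-- The Hardy space `H²` of the upper half-plane: `f` is analytic in `{Im ζ > 0}` (its values
elsewhere play no role) and the `L²(ℝ)` norms of `f(· + i y)`, `y > 0`, are bounded. -/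
def MemHardy (f : ℂ → ℂ) : Prop :=
  DifferentiableOn ℂ f {ζ : ℂ | 0 < ζ.im} ∧
    ∃ C : NNReal, ∀ y : ℝ, 0 < y →
      eLpNorm (fun x : ℝ => f ((x : ℂ) + (y : ℂ) * Complex.I)) 2 volume ≤ C

/-- `g` is the `L²(ℝ)` boundary function of `f`: `f(· + i h) → g` in `L²(ℝ)` as `h ↓ 0`. -/
def HasBoundaryData (f : ℂ → ℂ) (g : ℝ → ℂ) : Prop :=
  MemLp g 2 volume ∧
    Tendsto (fun h : ℝ =>
      eLpNorm (fun x : ℝ => f ((x : ℂ) + (h : ℂ) * Complex.I) - g x) 2 volume)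
      (𝓝[>] (0 : ℝ)) (𝓝 0)

open Classical in
/-- The boundary function of `f` on `ℝ` (determined up to null sets when it exists, which is
the case for every `f` in `H²`; the value is `0` if there is none). -/
noncomputable def boundaryData (f : ℂ → ℂ) : ℝ → ℂ :=
  if h : ∃ g : ℝ → ℂ, HasBoundaryData f g then h.choose else 0

/-- The norm of `H²`: the `L²(ℝ)` norm of the boundary function. -/
noncomputable def hardyNorm (f : ℂ → ℂ) : ℝ :=
  (eLpNorm (boundaryData f) 2 volume).toReal

/-- Lebesgue measure on the interval `(-1, 1)`. -/
noncomputable def intervalMeasure : Measure ℝ := volume.restrict (Set.Ioo (-1 : ℝ) 1)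

/-- The `L²(-1, 1)` norm of a function on the line. -/
noncomputable def normL2Interval (g : ℝ → ℂ) : ℝ :=
  (eLpNorm g 2 intervalMeasure).toReal

/-- `p_z(ζ) = i / (ζ - conj z)`. -/
noncomputable def pKernel (z ζ : ℂ) : ℂ := Complex.I / (ζ - (starRingEnd ℂ) z)

/-- The principal value `p.v. ∫_{-1}^1 u(y) / (x - y) dy` exists and equals `l`. -/
def HasPrincipalValue (u : ℝ → ℂ) (x : ℝ) (l : ℂ) : Prop :=
  Tendsto (fun δ : ℝ =>
      ∫ y in Set.Ioo (-1 : ℝ) 1 ∩ {y : ℝ | δ < |x - y|}, u y / ((x : ℂ) - (y : ℂ)))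
    (𝓝[>] (0 : ℝ)) (𝓝 l)

/-- `u ∈ L²(-1, 1)` solves `½ (K u + u) + ε² u = p_z` almost everywhere on `(-1, 1)`, where
`K u (x) = (i / π) p.v. ∫_{-1}^1 u(y) / (x - y) dy`; the existence of the principal value at
almost every point is part of being a solution. -/
def SolvesSingularEquation (ε : ℝ) (z : ℂ) (u : ℝ → ℂ) : Prop :=
  MemLp u 2 intervalMeasure ∧
    ∀ᵐ x : ℝ ∂intervalMeasure, ∃ l : ℂ, HasPrincipalValue u x l ∧
      (1 / 2 : ℂ) * (Complex.I / (Real.pi : ℂ) * l + u x) + (ε : ℂ) ^ 2 * u x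
        = pKernel z (x : ℂ)

/-- The extension of a solution `u` from `(-1, 1)` to the upper half-plane, given by
`ε² u(ζ) = p_z(ζ) - (i / 2π) ∫_{-1}^1 u(y) / (ζ - y) dy`. -/
noncomputable def solutionExtension (ε : ℝ) (z : ℂ) (u : ℝ → ℂ) (ζ : ℂ) : ℂ :=
  (pKernel z ζ - Complex.I / (2 * (Real.pi : ℂ)) * ∫ y, u y / (ζ - (y : ℂ)) ∂intervalMeasure)
    / (ε : ℂ) ^ 2

/-! Write `F` for the Cauchy transform of `u`, that is `i/(2π) ∫ u(y)/(ζ-y) dy`, and `G` for its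
boundary function. The Plemelj jump relation says `G = (Ku + u)/2` a.e. on `(-1,1)`, so the equation
reads `T u + ε² u = p_z`, where `T u` is the restriction of `G` to the interval. The Cauchy
transform is adjoint to restriction of `H²` boundary functions, hence `⟨T u, u⟩ = ‖G‖² ≥ 0`. Thus `T
+ ε²` is coercive and invertible, which gives existence and uniqueness. The solution is nonzero
because `p_z` has no zeros.

The extension is an `H²` function with boundary function `V`, and `ε² V + G = p_z` on all of `ℝ`;
the equation forces `V = u` on the interval. Pairing with `f` in `H²`, and using that `p_z`
reproduces point values up to the factor `2π`, gives `2π f(z) = ε² ⟨f, V⟩_ℝ + ⟨f, u⟩_(-1,1)`. Taking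
the extension for `f` yields `2π u(z) = ε² a² + b²` with `a = ‖V‖` and `b = ‖u‖`, a real number. An
admissible `f` gives `2π |f(z)| ≤ ε² a + ε b`, and the constant `3/2` comes from `εab ≤ (ε²a² +
b²)/2`.

The Hardy space facts are built from contour shifts: Cauchy's formula on lines
(`MemHardy.integral_line_mul_inv`), boundary functions (`MemHardy.exists_hasBoundaryData`), the
bound `‖F‖ ≤ ‖u‖` (`l2Norm_cauchyTransform_line_le`), and the jump relation
(`ae_hasPrincipalValue`), which rests on Lebesgue points and comparison with the Poisson kernel. -/

/-! ### Shifting horizontal lines of integration -/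

/-- A function analytic on a closed horizontal strip is integrable on a horizontal line of the
strip as soon as it is integrable there away from the origin. -/
theorem integrable_horizontal {G : ℂ → ℂ} {y R₀ : ℝ} {M : NNReal}
    (hG : ∀ x : ℝ, ContinuousAt G (x + y * Complex.I))
    (hM : ∫⁻ x in {x : ℝ | R₀ ≤ |x|}, ‖G (x + y * Complex.I)‖ₑ ≤ M) :
    Integrable fun x : ℝ => G (x + y * Complex.I) := by
  have hc : Continuous fun x : ℝ => G (x + y * Complex.I) := by
    rw [continuous_iff_continuousAt]
    intro x
    exact ContinuousAt.comp (f := fun x : ℝ => (x : ℂ) + y * Complex.I) (hG x) (by fun_prop)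
  rw [← integrableOn_univ, ← Set.union_compl_self {x : ℝ | R₀ ≤ |x|}]
  refine IntegrableOn.union ⟨hc.aestronglyMeasurable, ?_⟩ ?_
  · exact lt_of_le_of_lt hM ENNReal.coe_lt_top
  · refine (hc.integrableOn_Icc (a := -R₀) (b := R₀)).mono_set ?_
    intro x hx
    simp only [Set.mem_compl_iff, Set.mem_ofPred_eq, not_le] at hx
    exact ⟨(abs_lt.mp hx).1.le, (abs_lt.mp hx).2.le⟩

/-- No pointwise decay is available on the vertical sides of a rectangle. Their contribution `V R +
V (-R)` is integrable in `R` by Tonelli, though, while Cauchy's theorem would keep it above `D / 2`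
for all large `R` if the two integrals differed by `D > 0`. Bounding only `|x| ≥ R₀` lets the strip
contain removed singularities. -/
theorem integral_horizontal_eq {G : ℂ → ℂ} {c d R₀ : ℝ} {M : NNReal} (hcd : c ≤ d)
    (hG : ∀ ζ : ℂ, c ≤ ζ.im → ζ.im ≤ d → DifferentiableAt ℂ G ζ)
    (hM : ∀ y ∈ Set.Icc c d, ∫⁻ x in {x : ℝ | R₀ ≤ |x|}, ‖G (x + y * Complex.I)‖ₑ ≤ M) :
    ∫ x : ℝ, G (x + c * Complex.I) = ∫ x : ℝ, G (x + d * Complex.I) := by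
  have hcont : ∀ y ∈ Set.Icc c d, ∀ x : ℝ, ContinuousAt G (x + y * Complex.I) := fun y hy x =>
    (hG _ (by simpa using hy.1) (by simpa using hy.2)).continuousAt
  have hic := integrable_horizontal (hcont c ⟨le_rfl, hcd⟩) (hM c ⟨le_rfl, hcd⟩)
  have hid := integrable_horizontal (hcont d ⟨hcd, le_rfl⟩) (hM d ⟨hcd, le_rfl⟩)
  set V : ℝ → ENNReal := fun x => ∫⁻ y in Set.Icc c d, ‖G (x + y * Complex.I)‖ₑ with hV
  have hVfin : ∫⁻ x in {x : ℝ | R₀ ≤ |x|}, V x < ⊤ := by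
    rw [hV, lintegral_lintegral_swap]
    · calc ∫⁻ y in Set.Icc c d, ∫⁻ x in {x : ℝ | R₀ ≤ |x|}, ‖G (x + y * Complex.I)‖ₑ
          ≤ ∫⁻ y in Set.Icc c d, (M : ENNReal) :=
            setLIntegral_mono' measurableSet_Icc fun y hy => hM y hy
        _ < ⊤ := by
            rw [setLIntegral_const]
            exact ENNReal.mul_lt_top ENNReal.coe_lt_top measure_Icc_lt_top
    · have : ContinuousOn (Function.uncurry fun x y : ℝ => G (x + y * Complex.I))
          ({x : ℝ | R₀ ≤ |x|} ×ˢ Set.Icc c d) := by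
        rintro ⟨x, y⟩ ⟨_, hy⟩
        refine ContinuousAt.continuousWithinAt ?_
        exact ContinuousAt.comp (f := fun p : ℝ × ℝ => (p.1 : ℂ) + p.2 * Complex.I)
          (g := G) (hcont y hy x) (by fun_prop)
      rw [Measure.prod_restrict]
      exact (this.aestronglyMeasurable
        ((measurableSet_le measurable_const (by fun_prop)).prod measurableSet_Icc)).enorm
  have hrect : ∀ R : ℝ, ENNReal.ofReal ‖(∫ x in -R..R, G (x + c * Complex.I)) -
      ∫ x in -R..R, G (x + d * Complex.I)‖ ≤ V R + V (-R) := by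
    intro R
    have h := Complex.integral_boundary_rect_eq_zero_of_differentiableOn G ⟨-R, c⟩ ⟨R, d⟩
      (by
        intro ζ hζ
        rw [Complex.mem_reProdIm] at hζ
        simp only [Set.uIcc_of_le hcd] at hζ
        exact (hG ζ hζ.2.1 hζ.2.2).differentiableWithinAt)
    simp only [smul_eq_mul] at h
    have hv : ∀ a : ℝ, ENNReal.ofReal ‖∫ y in c..d, G (a + y * Complex.I)‖ ≤ V a := by
      intro a
      rw [ofReal_norm, intervalIntegral.integral_of_le hcd,
        ← integral_Icc_eq_integral_Ioc]
      exact enorm_integral_le_lintegral_enorm _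
    have h' : (∫ x in -R..R, G (x + c * Complex.I)) - ∫ x in -R..R, G (x + d * Complex.I) =
        Complex.I * (∫ y in c..d, G ((-R : ℝ) + y * Complex.I))
          - Complex.I * ∫ y in c..d, G (R + y * Complex.I) := by
      linear_combination h
    rw [h', add_comm (V R)]
    refine le_trans ?_ (add_le_add (hv (-R)) (hv R))
    rw [← ENNReal.ofReal_add (norm_nonneg _) (norm_nonneg _)]
    refine ENNReal.ofReal_le_ofReal ((norm_sub_le _ _).trans ?_)
    simp
  have hlim := (intervalIntegral_tendsto_integral hic tendsto_neg_atTop_atBot tendsto_id).sub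
    (intervalIntegral_tendsto_integral hid tendsto_neg_atTop_atBot tendsto_id)
  by_contra hne
  have hpos : 0 < ‖(∫ x : ℝ, G (x + c * Complex.I)) - ∫ x : ℝ, G (x + d * Complex.I)‖ :=
    norm_pos_iff.mpr (sub_ne_zero.mpr hne)
  set D := ‖(∫ x : ℝ, G (x + c * Complex.I)) - ∫ x : ℝ, G (x + d * Complex.I)‖
  obtain ⟨R₁, hR₁⟩ := eventually_atTop.mp
    (hlim.norm.eventually (lt_mem_nhds (half_lt_self hpos)))
  set R₂ := max R₁ (max R₀ 0)
  have hlow : ∀ R ∈ Set.Ici R₂, ENNReal.ofReal (D / 2) ≤ V R + V (-R) := fun R hR =>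
    (ENNReal.ofReal_le_ofReal (hR₁ R ((le_max_left _ _).trans hR)).le).trans (hrect R)
  have h1 : ∫⁻ R in Set.Ici R₂, V R ≤ ∫⁻ x in {x : ℝ | R₀ ≤ |x|}, V x := by
    refine lintegral_mono_set fun x hx => ?_
    exact ((le_max_left _ _).trans (le_max_right _ _)).trans (le_trans hx (le_abs_self x))
  have h2 : ∫⁻ R in Set.Ici R₂, V (-R) ≤ ∫⁻ x in {x : ℝ | R₀ ≤ |x|}, V x := by
    refine ((Measure.measurePreserving_neg (volume : Measure ℝ)).setLIntegral_comp_emb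
      (MeasurableEquiv.neg ℝ).measurableEmbedding V (Set.Ici R₂)).trans_le (lintegral_mono_set ?_)
    rintro _ ⟨x, hx, rfl⟩
    have : R₀ ≤ x := ((le_max_left _ _).trans (le_max_right _ _)).trans hx
    simpa using this.trans (le_abs_self x)
  have hVm : Measurable fun x => V x := by
    -- Continuity of `G` is known only on the strip; clamping `y` to `[c, d]` makes the integrand
    -- continuous on the whole plane.
    have : Measurable (Function.uncurry fun x y : ℝ =>
        ‖G (x + (max c (min d y) : ℝ) * Complex.I)‖ₑ) := by
      refine (Continuous.enorm ?_).measurable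
      rw [continuous_iff_continuousAt]
      rintro ⟨x, y⟩
      exact ContinuousAt.comp (g := G)
        (f := fun p : ℝ × ℝ => (p.1 : ℂ) + (max c (min d p.2) : ℝ) * Complex.I)
        (hcont _ ⟨le_max_left _ _, max_le hcd (min_le_left _ _)⟩ x) (by fun_prop)
    have h3 := this.lintegral_prod_right' (ν := volume.restrict (Set.Icc c d))
    convert h3 using 2 with x
    refine setLIntegral_congr_fun measurableSet_Icc fun y hy => ?_
    simp [Function.uncurry, min_eq_right hy.2, max_eq_right hy.1]
  have h4 : ∫⁻ R in Set.Ici R₂, ENNReal.ofReal (D / 2) ≤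
      ∫⁻ R in Set.Ici R₂, (V R + V (-R)) := setLIntegral_mono' measurableSet_Ici hlow
  rw [lintegral_add_left hVm, setLIntegral_const, Real.volume_Ici,
    ENNReal.mul_top (by simpa using hpos)] at h4
  exact absurd h4 (not_le.mpr ((add_le_add h1 h2).trans_lt (ENNReal.add_lt_top.mpr ⟨hVfin, hVfin⟩)))

/-! ### Norms and pairings in `L²` -/

/-- The `L²(μ)` norm as a real number. -/
noncomputable def l2Norm (μ : Measure ℝ) (f : ℝ → ℂ) : ℝ := (eLpNorm f 2 μ).toReal

section L2
variable {μ : Measure ℝ} {f g k : ℝ → ℂ}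

theorem l2Norm_nonneg : 0 ≤ l2Norm μ f := ENNReal.toReal_nonneg

theorem l2Norm_sq (hf : MemLp f 2 μ) : l2Norm μ f ^ 2 = ∫ x, ‖f x‖ ^ 2 ∂μ := by
  have h := hf.eLpNorm_eq_integral_rpow_norm (by norm_num) (by norm_num)
  have h0 : 0 ≤ ∫ x, ‖f x‖ ^ 2 ∂μ := integral_nonneg fun x => by positivity
  have h1 : l2Norm μ f = Real.sqrt (∫ x, ‖f x‖ ^ 2 ∂μ) := by
    rw [l2Norm, h, ENNReal.toReal_ofReal (by positivity), Real.sqrt_eq_rpow]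
    norm_num
  rw [h1, Real.sq_sqrt h0]

theorem lintegral_enorm_mul_le (hf : AEStronglyMeasurable f μ) (hg : AEStronglyMeasurable g μ) :
    ∫⁻ x, ‖f x * g x‖ₑ ∂μ ≤ eLpNorm f 2 μ * eLpNorm g 2 μ := by
  have h := eLpNorm_smul_le_mul_eLpNorm (p := 2) (q := 2) (r := 1) hg hf
  rwa [eLpNorm_one_eq_lintegral_enorm] at h

theorem integrable_mul_of_memLp (hf : MemLp f 2 μ) (hg : MemLp g 2 μ) :
    Integrable (fun x => f x * g x) μ := hf.integrable_mul hg

theorem norm_integral_mul_le (hf : MemLp f 2 μ) (hg : MemLp g 2 μ) :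
    ‖∫ x, f x * g x ∂μ‖ ≤ l2Norm μ f * l2Norm μ g := by
  rw [← toReal_enorm, l2Norm, l2Norm, ← ENNReal.toReal_mul]
  exact ENNReal.toReal_mono (ENNReal.mul_ne_top hf.2.ne hg.2.ne)
    ((enorm_integral_le_lintegral_enorm _).trans (lintegral_enorm_mul_le hf.1 hg.1))

theorem memLp_conj (hf : MemLp f 2 μ) : MemLp (fun x => (starRingEnd ℂ) (f x)) 2 μ := hf.star

theorem l2Norm_conj : l2Norm μ (fun x => (starRingEnd ℂ) (f x)) = l2Norm μ f := by
  unfold l2Norm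
  congr 1
  exact eLpNorm_congr_norm_ae (Eventually.of_forall fun x => by simp)

theorem integral_mul_conj_self (hf : MemLp f 2 μ) :
    ∫ x, f x * (starRingEnd ℂ) (f x) ∂μ = ((l2Norm μ f ^ 2 : ℝ) : ℂ) := by
  rw [l2Norm_sq hf, ← integral_complex_ofReal]
  congr 1 with x
  rw [Complex.mul_conj, Complex.normSq_eq_norm_sq]

theorem tendsto_integral_mul {ι : Type*} {l : Filter ι} {F : ι → ℝ → ℂ}
    (hF : ∀ᶠ i in l, MemLp (F i) 2 μ) (hg : MemLp g 2 μ) (hk : MemLp k 2 μ)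
    (h : Tendsto (fun i => eLpNorm (fun x => F i x - g x) 2 μ) l (𝓝 0)) :
    Tendsto (fun i => ∫ x, F i x * k x ∂μ) l (𝓝 (∫ x, g x * k x ∂μ)) := by
  rw [tendsto_iff_norm_sub_tendsto_zero]
  have h0 : Tendsto (fun i => l2Norm μ (fun x => F i x - g x) * l2Norm μ k) l (𝓝 0) := by
    have := (ENNReal.tendsto_toReal ENNReal.zero_ne_top).comp h
    have := this.mul_const (l2Norm μ k)
    rwa [ENNReal.toReal_zero, zero_mul] at this
  refine squeeze_zero' (Eventually.of_forall fun _ => norm_nonneg _) ?_ h0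
  filter_upwards [hF] with i hi
  rw [← integral_sub (integrable_mul_of_memLp hi hk) (integrable_mul_of_memLp hg hk)]
  simp_rw [← sub_mul]
  exact norm_integral_mul_le (hi.sub hg) hk

theorem tendsto_l2Norm {ι : Type*} {l : Filter ι} {F : ι → ℝ → ℂ}
    (hF : ∀ᶠ i in l, MemLp (F i) 2 μ) (hg : MemLp g 2 μ)
    (h : Tendsto (fun i => eLpNorm (fun x => F i x - g x) 2 μ) l (𝓝 0)) :
    Tendsto (fun i => l2Norm μ (F i)) l (𝓝 (l2Norm μ g)) := by
  rw [tendsto_iff_norm_sub_tendsto_zero]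
  have h0 : Tendsto (fun i => l2Norm μ (fun x => F i x - g x)) l (𝓝 0) := by
    have := (ENNReal.tendsto_toReal ENNReal.zero_ne_top).comp h
    rwa [ENNReal.toReal_zero] at this
  refine squeeze_zero' (Eventually.of_forall fun _ => norm_nonneg _) ?_ h0
  filter_upwards [hF] with i hi
  have h1 := abs_norm_sub_norm_le (hi.toLp (F i)) (hg.toLp g)
  rw [← MemLp.toLp_sub, Lp.norm_toLp, Lp.norm_toLp, Lp.norm_toLp] at h1
  exact h1

end L2

/-! ### Poisson and Cauchy kernels on horizontal lines -/

theorem integrable_poissonKernel (a : ℝ) {b : ℝ} (hb : 0 < b) :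
    Integrable fun x : ℝ => b / ((x - a) ^ 2 + b ^ 2) := by
  have h := ((integrable_inv_one_add_sq.comp_div hb.ne').comp_sub_right a).const_mul b⁻¹
  convert h using 2 with x
  field_simp
  ring

theorem integral_poissonKernel (a : ℝ) {b : ℝ} (hb : 0 < b) :
    ∫ x : ℝ, b / ((x - a) ^ 2 + b ^ 2) = Real.pi := by
  have h1 : ∀ x : ℝ, b / ((x - a) ^ 2 + b ^ 2) = b⁻¹ * (1 + ((x - a) / b) ^ 2)⁻¹ := by
    intro x
    field_simp
    ring
  simp_rw [h1]
  rw [integral_const_mul, integral_sub_right_eq_self (fun x : ℝ => (1 + (x / b) ^ 2)⁻¹),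
    Measure.integral_comp_div (fun x : ℝ => (1 + x ^ 2)⁻¹), integral_univ_inv_one_add_sq,
    abs_of_pos hb, smul_eq_mul, inv_mul_cancel_left₀ hb.ne']

theorem norm_inv_ofReal_sub_sq (w : ℂ) (x : ℝ) :
    ‖((x : ℂ) - w)⁻¹‖ ^ 2 = ((x - w.re) ^ 2 + |w.im| ^ 2)⁻¹ := by
  rw [norm_inv, inv_pow, ← Complex.normSq_eq_norm_sq, Complex.normSq_apply]
  simp only [Complex.sub_re, Complex.ofReal_re, Complex.sub_im, Complex.ofReal_im, sq_abs]
  congr 1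
  ring

theorem ofReal_sub_ne_zero {w : ℂ} (hw : w.im ≠ 0) (x : ℝ) : (x : ℂ) - w ≠ 0 := by
  intro h
  apply hw
  rw [← sub_eq_zero.mp h, Complex.ofReal_im]

theorem continuous_inv_ofReal_sub {w : ℂ} (hw : w.im ≠ 0) :
    Continuous fun x : ℝ => ((x : ℂ) - w)⁻¹ :=
  Continuous.inv₀ (by fun_prop) (ofReal_sub_ne_zero hw)

theorem memLp_inv_ofReal_sub {w : ℂ} (hw : w.im ≠ 0) :
    MemLp (fun x : ℝ => ((x : ℂ) - w)⁻¹) 2 volume := by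
  rw [memLp_two_iff_integrable_sq_norm (continuous_inv_ofReal_sub hw).aestronglyMeasurable]
  have h := (integrable_poissonKernel w.re (abs_pos.mpr hw)).const_mul |w.im|⁻¹
  refine h.congr (Eventually.of_forall fun x => ?_)
  have := abs_pos.mpr hw
  beta_reduce
  rw [norm_inv_ofReal_sub_sq]
  field_simp

theorem l2Norm_inv_ofReal_sub_sq {w : ℂ} (hw : w.im ≠ 0) :
    l2Norm volume (fun x : ℝ => ((x : ℂ) - w)⁻¹) ^ 2 = Real.pi / |w.im| := by
  rw [l2Norm_sq (memLp_inv_ofReal_sub hw)]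
  have : ∀ x : ℝ, ‖((x : ℂ) - w)⁻¹‖ ^ 2
      = |w.im|⁻¹ * (|w.im| / ((x - w.re) ^ 2 + |w.im| ^ 2)) := by
    intro x
    have := abs_pos.mpr hw
    rw [norm_inv_ofReal_sub_sq]
    field_simp
  simp_rw [this]
  rw [integral_const_mul, integral_poissonKernel _ (abs_pos.mpr hw)]
  field_simp

/-- The strip lemma for a function dominated near infinity by the product of a function with
bounded `L²` norms on horizontal lines and a fixed `L²` function. -/
theorem integral_horizontal_eq_of_norm_le_mul {G F : ℂ → ℂ} {k : ℝ → ℂ} {c d R₀ : ℝ} {C : NNReal}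
    (hcd : c ≤ d) (hG : ∀ ζ : ℂ, c ≤ ζ.im → ζ.im ≤ d → DifferentiableAt ℂ G ζ)
    (hF : ∀ y ∈ Set.Icc c d,
      AEStronglyMeasurable (fun x : ℝ => F (x + y * Complex.I)) volume)
    (hC : ∀ y ∈ Set.Icc c d, eLpNorm (fun x : ℝ => F (x + y * Complex.I)) 2 volume ≤ C)
    (hk : MemLp k 2 volume)
    (hle : ∀ y ∈ Set.Icc c d, ∀ x : ℝ, R₀ ≤ |x| →
      ‖G (x + y * Complex.I)‖ ≤ ‖F (x + y * Complex.I) * k x‖) :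
    ∫ x : ℝ, G (x + c * Complex.I) = ∫ x : ℝ, G (x + d * Complex.I) := by
  refine integral_horizontal_eq (R₀ := R₀)
    (M := C * (eLpNorm k 2 volume).toNNReal) hcd hG fun y hy => ?_
  calc ∫⁻ x : ℝ in {x : ℝ | R₀ ≤ |x|}, ‖G (x + y * Complex.I)‖ₑ
      ≤ ∫⁻ x : ℝ in {x : ℝ | R₀ ≤ |x|}, ‖F (x + y * Complex.I) * k x‖ₑ :=
        setLIntegral_mono' (measurableSet_le measurable_const (by fun_prop)) fun x hx =>
          enorm_le_iff_norm_le.mpr (hle y hy x hx)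
    _ ≤ ∫⁻ x : ℝ, ‖F (x + y * Complex.I) * k x‖ₑ := setLIntegral_le_lintegral _ _
    _ ≤ eLpNorm (fun x : ℝ => F (x + y * Complex.I)) 2 volume * eLpNorm k 2 volume :=
        lintegral_enorm_mul_le (hF y hy) hk.1
    _ ≤ _ := by
        rw [ENNReal.coe_mul, ENNReal.coe_toNNReal hk.2.ne]
        gcongr
        exact hC y hy

/-- This supplies one `L²` majorant for the kernel on all lines above height `h`, as the strip lemma
requires. -/
theorem norm_inv_line_le {w : ℂ} {h y : ℝ} (hw : w.im < h) (hy : h ≤ y) (x : ℝ) :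
    ‖((x : ℂ) + y * Complex.I - w)⁻¹‖ ≤ ‖((x : ℂ) - (w - h * Complex.I))⁻¹‖ := by
  have e : (x : ℂ) + y * Complex.I - w = x - (w - y * Complex.I) := by ring
  rw [e, ← abs_of_nonneg (norm_nonneg ((x : ℂ) - (w - y * Complex.I))⁻¹),
    ← abs_of_nonneg (norm_nonneg ((x : ℂ) - (w - h * Complex.I))⁻¹), ← sq_le_sq,
    norm_inv_ofReal_sub_sq, norm_inv_ofReal_sub_sq]
  simp only [Complex.sub_re, Complex.mul_re, Complex.ofReal_re, Complex.I_re, Complex.ofReal_im,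
    Complex.I_im, Complex.sub_im, Complex.mul_im, sq_abs]
  have h1 : 0 < h - w.im := sub_pos.mpr hw
  have h2 : (h - w.im) ^ 2 ≤ (y - w.im) ^ 2 := by gcongr
  apply inv_anti₀
  · nlinarith [sq_nonneg (x - w.re)]
  · nlinarith

theorem l2Norm_inv_line {w : ℂ} {y : ℝ} (hw : w.im < y) :
    l2Norm volume (fun x : ℝ => ((x : ℂ) + y * Complex.I - w)⁻¹)
      = Real.sqrt (Real.pi / (y - w.im)) := by
  have e : ∀ x : ℝ, (x : ℂ) + y * Complex.I - w = x - (w - y * Complex.I) := fun x => by ring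
  have hne : (w - y * Complex.I).im ≠ 0 := by
    simp only [Complex.sub_im, Complex.mul_im, Complex.ofReal_re, Complex.I_im, Complex.ofReal_im,
      Complex.I_re]
    linarith
  have ha : |(w - y * Complex.I).im| = y - w.im := by
    have e1 : (w - y * Complex.I).im = w.im - y := by simp
    rw [e1, abs_sub_comm, abs_of_pos (sub_pos.mpr hw)]
  simp_rw [e]
  rw [← ha, ← l2Norm_inv_ofReal_sub_sq hne, Real.sqrt_sq l2Norm_nonneg]

theorem memLp_inv_line {w : ℂ} {y : ℝ} (hw : w.im < y) :
    MemLp (fun x : ℝ => ((x : ℂ) + y * Complex.I - w)⁻¹) 2 volume := by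
  have e : ∀ x : ℝ, (x : ℂ) + y * Complex.I - w = x - (w - y * Complex.I) := fun x => by ring
  have hne : (w - y * Complex.I).im ≠ 0 := by
    simp only [Complex.sub_im, Complex.mul_im, Complex.ofReal_re, Complex.I_im, Complex.ofReal_im,
      Complex.I_re]
    linarith
  simp_rw [e]
  exact memLp_inv_ofReal_sub hne

/-- A number that is bounded by pairings of a bounded family in `L²` with Cauchy kernels whose
poles move to infinity vanishes. -/
theorem eq_zero_of_integral_line {F : ℂ → ℂ} {w J : ℂ} {C h : ℝ}
    (hF : ∀ d : ℝ, h < d → MemLp (fun x : ℝ => F (x + d * Complex.I)) 2 volume)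
    (hC : ∀ d : ℝ, h < d → l2Norm volume (fun x : ℝ => F (x + d * Complex.I)) ≤ C)
    (hw : w.im ≤ h)
    (hJ : ∀ d : ℝ, h < d →
      J = ∫ x : ℝ, F (x + d * Complex.I) * ((x : ℂ) + d * Complex.I - w)⁻¹) : J = 0 := by
  have hle : ∀ d : ℝ, h < d → ‖J‖ ≤ C * Real.sqrt (Real.pi / (d - w.im)) := by
    intro d hd
    rw [hJ d hd, ← l2Norm_inv_line (hw.trans_lt hd)]
    exact (norm_integral_mul_le (hF d hd) (memLp_inv_line (hw.trans_lt hd))).trans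
      (mul_le_mul_of_nonneg_right (hC d hd) l2Norm_nonneg)
  have hlim : Tendsto (fun d : ℝ => C * Real.sqrt (Real.pi / (d - w.im))) atTop (𝓝 0) := by
    have h1 : Tendsto (fun d : ℝ => Real.pi / (d - w.im)) atTop (𝓝 0) :=
      Tendsto.div_atTop tendsto_const_nhds (tendsto_atTop_add_const_right _ _ tendsto_id)
    simpa using (h1.sqrt).const_mul C
  exact norm_le_zero_iff.mp
    (ge_of_tendsto hlim ((eventually_gt_atTop h).mono hle))

/-! ### Cauchy's formula on horizontal lines -/

section Hardy
variable {f : ℂ → ℂ}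

theorem MemHardy.differentiableAt (hf : MemHardy f) {ζ : ℂ} (hζ : 0 < ζ.im) :
    DifferentiableAt ℂ f ζ :=
  hf.1.differentiableAt ((isOpen_lt continuous_const Complex.continuous_im).mem_nhds hζ)

theorem MemHardy.continuous_line (hf : MemHardy f) {y : ℝ} (hy : 0 < y) :
    Continuous fun x : ℝ => f (x + y * Complex.I) := by
  rw [continuous_iff_continuousAt]
  intro x
  exact ContinuousAt.comp (f := fun x : ℝ => (x : ℂ) + y * Complex.I)
    (hf.differentiableAt (by simpa using hy)).continuousAt (by fun_prop)

theorem MemHardy.memLp_line (hf : MemHardy f) {y : ℝ} (hy : 0 < y) :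
    MemLp (fun x : ℝ => f (x + y * Complex.I)) 2 volume := by
  obtain ⟨C, hC⟩ := hf.2
  exact ⟨(hf.continuous_line hy).aestronglyMeasurable, (hC y hy).trans_lt ENNReal.coe_lt_top⟩

theorem MemHardy.exists_l2Norm_le (hf : MemHardy f) :
    ∃ C : ℝ, ∀ y : ℝ, 0 < y → l2Norm volume (fun x : ℝ => f (x + y * Complex.I)) ≤ C := by
  obtain ⟨C, hC⟩ := hf.2
  exact ⟨C, fun y hy => ENNReal.toReal_le_coe_of_le_coe (hC y hy)⟩

/-- The integrand is analytic on and above the line, so the line can be pushed up to infinity, where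
the `L²` norm of the kernel tends to zero. -/
theorem MemHardy.integral_line_mul_inv_eq_zero (hf : MemHardy f) {h : ℝ} (hh : 0 < h) {w : ℂ}
    (hw : w.im < h) :
    ∫ x : ℝ, f (x + h * Complex.I) * ((x : ℂ) + h * Complex.I - w)⁻¹ = 0 := by
  obtain ⟨C, hC⟩ := hf.2
  obtain ⟨C', hC'⟩ := hf.exists_l2Norm_le
  refine eq_zero_of_integral_line (F := f) (w := w) (h := h) (C := C')
    (fun d hd => hf.memLp_line (hh.trans hd)) (fun d hd => hC' d (hh.trans hd)) hw.le
    fun d hd => ?_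
  have hne : (w - h * Complex.I).im ≠ 0 := by
    simp only [Complex.sub_im, Complex.mul_im, Complex.ofReal_re, Complex.I_im, Complex.ofReal_im,
      Complex.I_re]
    linarith
  refine integral_horizontal_eq_of_norm_le_mul (G := fun ζ => f ζ * (ζ - w)⁻¹) (F := f) (C := C)
    (R₀ := 0) hd.le ?_ (fun y hy => (hf.continuous_line (hh.trans_le hy.1)).aestronglyMeasurable)
    (fun y hy => hC y (hh.trans_le hy.1)) (memLp_inv_ofReal_sub hne) ?_
  · intro ζ h1 _
    refine (hf.differentiableAt (hh.trans_le h1)).mul (DifferentiableAt.inv (by fun_prop) ?_)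
    intro h0
    rw [sub_eq_zero.mp h0] at h1
    linarith
  · intro y hy x _
    rw [norm_mul, norm_mul]
    exact mul_le_mul_of_nonneg_left (norm_inv_line_le hw hy.1 x) (norm_nonneg _)

/-- Subtract from `f` the multiple of the Cauchy kernel with pole `v`, the mirror image of `z` in
the line, that makes the difference `F` vanish at `z`. Then `F(ζ)/(ζ-z)` has no pole, and its
integral is zero by pushing the line up. On the line `ζ - v` is the conjugate of `ζ - z`, so the
subtracted term is a Poisson integral. -/
theorem MemHardy.integral_line_mul_inv (hf : MemHardy f) {h : ℝ} (hh : 0 < h) {z : ℂ}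
    (hz : h < z.im) :
    ∫ x : ℝ, f (x + h * Complex.I) * ((x : ℂ) + h * Complex.I - z)⁻¹
      = 2 * Real.pi * Complex.I * f z := by
  obtain ⟨C, hC⟩ := hf.2
  set v : ℂ := (starRingEnd ℂ) z + 2 * h * Complex.I with hv
  have hvim : v.im = 2 * h - z.im := by simp [hv]; ring
  have hvh : v.im < h := by linarith
  set F : ℂ → ℂ := fun ζ => f ζ - f z * (z - v) * (ζ - v)⁻¹ with hFdef
  have hzv : z - v ≠ 0 := fun h0 => by
    have := congrArg Complex.im h0
    simp only [Complex.sub_im, hvim, Complex.zero_im] at this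
    linarith
  have hFz : F z = 0 := by
    simp [hFdef, mul_assoc, hzv]
  have hFd : ∀ ζ : ℂ, h ≤ ζ.im → DifferentiableAt ℂ F ζ := by
    intro ζ hζ
    refine (hf.differentiableAt (hh.trans_le hζ)).sub
      ((DifferentiableAt.inv (by fun_prop) ?_).const_mul _)
    intro h0
    rw [sub_eq_zero.mp h0] at hζ
    linarith
  have hne : (v - h * Complex.I).im ≠ 0 := by
    simp only [Complex.sub_im, Complex.mul_im, Complex.ofReal_re, Complex.I_im, Complex.ofReal_im,
      Complex.I_re]
    linarith
  have hFL : ∀ y : ℝ, h ≤ y → MemLp (fun x : ℝ => F (x + y * Complex.I)) 2 volume := fun y hy =>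
    (hf.memLp_line (hh.trans_le hy)).sub ((memLp_inv_line (hvh.trans_le hy)).const_mul _)
  set E : ENNReal := eLpNorm (fun x : ℝ => f z * (z - v) * ((x : ℂ) - (v - h * Complex.I))⁻¹) 2
    volume with hE
  have hEt : E ≠ ⊤ := ((memLp_inv_ofReal_sub hne).const_mul _).2.ne
  have hFC : ∀ y : ℝ, h ≤ y → eLpNorm (fun x : ℝ => F (x + y * Complex.I)) 2 volume
      ≤ (C + E.toNNReal : NNReal) := by
    intro y hy
    refine (eLpNorm_sub_le (hf.memLp_line (hh.trans_le hy)).1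
      ((memLp_inv_line (hvh.trans_le hy)).const_mul _).1 (by norm_num)).trans ?_
    rw [ENNReal.coe_add, ENNReal.coe_toNNReal hEt]
    refine add_le_add (hC y (hh.trans_le hy)) (eLpNorm_mono fun x => ?_)
    rw [norm_mul, norm_mul _ (_)⁻¹]
    exact mul_le_mul_of_nonneg_left (norm_inv_line_le hvh hy x) (norm_nonneg _)
  have hG0 : ∀ y : ℝ, y ≠ z.im → ∀ x : ℝ, dslope F z (x + y * Complex.I)
      = F (x + y * Complex.I) * ((x : ℂ) + y * Complex.I - z)⁻¹ := by
    intro y hy x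
    rw [dslope_of_ne _ (fun h0 => hy (by simpa using congrArg Complex.im h0)), slope_def_field,
      hFz, sub_zero, div_eq_mul_inv]
  have hzero : ∫ x : ℝ, F (x + h * Complex.I) * ((x : ℂ) + h * Complex.I - z)⁻¹ = 0 := by
    refine eq_zero_of_integral_line (F := F) (w := z) (h := z.im) (C := (C + E.toNNReal : NNReal))
      (fun d hd => hFL d (hz.trans hd).le)
      (fun d hd => ENNReal.toReal_le_coe_of_le_coe (hFC d (hz.trans hd).le)) le_rfl fun d hd => ?_
    have hd' : h ≤ d := (hz.trans hd).le
    simp_rw [← hG0 h hz.ne, ← hG0 d hd.ne']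
    -- Some line of the strip passes through `z`, so the kernel is compared only where `|x - Re z| ≥
    -- 1`; there `|x - Re z| + 1 ≤ 2|x - Re z|`, whence the factor `2`.
    have hk : MemLp (fun x : ℝ => 2 * ((x : ℂ) - (z.re + Complex.I))⁻¹) 2 volume :=
      (memLp_inv_ofReal_sub (by simp)).const_mul _
    refine integral_horizontal_eq_of_norm_le_mul (F := F) (C := C + E.toNNReal)
      (R₀ := |z.re| + 1) hd' ?_ (fun y hy => (hFL y hy.1).1) (fun y hy => hFC y hy.1) hk ?_
    · intro ζ h1 _
      by_cases hζz : ζ = z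
      · rw [hζz]
        have hn : {ζ : ℂ | h < ζ.im} ∈ 𝓝 z :=
          (isOpen_lt continuous_const Complex.continuous_im).mem_nhds hz
        exact ((Complex.differentiableOn_dslope hn).mpr fun ζ hζ =>
          (hFd ζ (le_of_lt hζ)).differentiableWithinAt).differentiableAt hn
      · exact (differentiableAt_dslope_of_ne hζz).mpr (hFd ζ h1)
    · intro y hy x hx
      have hx1 : 1 ≤ |x - z.re| := by
        have := abs_sub_abs_le_abs_sub x z.re
        linarith
      have hxz : (x : ℂ) + y * Complex.I ≠ z := by
        intro h0
        have : x = z.re := by simpa using congrArg Complex.re h0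
        rw [this, sub_self, abs_zero] at hx1
        linarith
      rw [dslope_of_ne _ hxz, slope_def_field, hFz, sub_zero, div_eq_mul_inv, norm_mul, norm_mul]
      refine mul_le_mul_of_nonneg_left ?_ (norm_nonneg _)
      have h1 : |x - z.re| ≤ ‖(x : ℂ) + y * Complex.I - z‖ := by
        simpa using Complex.abs_re_le_norm ((x : ℂ) + y * Complex.I - z)
      have h2 : ‖(x : ℂ) - (z.re + Complex.I)‖ ≤ |x - z.re| + 1 := by
        have e : (x : ℂ) - (z.re + Complex.I) = ((x - z.re : ℝ) : ℂ) - Complex.I := by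
          push_cast; ring
        rw [e]
        refine (norm_sub_le _ _).trans ?_
        rw [Complex.norm_I, Complex.norm_real, Real.norm_eq_abs]
      have h3 : 0 < ‖(x : ℂ) - (z.re + Complex.I)‖ :=
        norm_pos_iff.mpr (ofReal_sub_ne_zero (by simp) x)
      rw [norm_mul, norm_inv, norm_inv, Complex.norm_ofNat, ← div_eq_mul_inv, ← one_div,
        div_le_div_iff₀ (by linarith) h3]
      linarith
  have hb : 0 < z.im - h := sub_pos.mpr hz
  have hker : ∀ x : ℝ, ((x : ℂ) + h * Complex.I - v)⁻¹ * ((x : ℂ) + h * Complex.I - z)⁻¹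
      = ((((z.im - h) / ((x - z.re) ^ 2 + (z.im - h) ^ 2)) / (z.im - h) : ℝ) : ℂ) := by
    intro x
    have e : (x : ℂ) + h * Complex.I - v = (starRingEnd ℂ) ((x : ℂ) + h * Complex.I - z) := by
      simp [hv]; ring
    rw [← mul_inv, e, mul_comm, Complex.mul_conj, Complex.normSq_apply]
    simp only [Complex.sub_re, Complex.add_re, Complex.ofReal_re, Complex.mul_re, Complex.I_re,
      Complex.ofReal_im, Complex.I_im, Complex.sub_im, Complex.add_im, Complex.mul_im]
    rw [← Complex.ofReal_inv, div_div_cancel_left' hb.ne']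
    congr 2
    ring
  have hsplit : ∫ x : ℝ, F (x + h * Complex.I) * ((x : ℂ) + h * Complex.I - z)⁻¹
      = (∫ x : ℝ, f (x + h * Complex.I) * ((x : ℂ) + h * Complex.I - z)⁻¹)
        - f z * (z - v) * ∫ x : ℝ,
          ((x : ℂ) + h * Complex.I - v)⁻¹ * ((x : ℂ) + h * Complex.I - z)⁻¹ := by
    have hz1 : MemLp (fun x : ℝ => ((x : ℂ) + h * Complex.I - z)⁻¹) 2 volume := by
      have e : ∀ x : ℝ, (x : ℂ) + h * Complex.I - z = x - (z - h * Complex.I) := fun x => by ring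
      simp_rw [e]
      refine memLp_inv_ofReal_sub ?_
      simp
      linarith
    rw [← integral_const_mul, ← integral_sub (integrable_mul_of_memLp (hf.memLp_line hh) hz1)
      ((integrable_mul_of_memLp (memLp_inv_line hvh) hz1).const_mul _)]
    congr 1 with x
    simp only [hFdef]
    ring
  rw [hsplit] at hzero
  simp_rw [hker] at hzero
  rw [integral_complex_ofReal, integral_div, integral_poissonKernel _ hb, sub_eq_zero] at hzero
  rw [hzero]
  have hzv' : z - v = 2 * (z.im - h : ℝ) * Complex.I := by
    apply Complex.ext
    · simp [hv]
    · simp [hv]; ring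
  have hbc : ((z.im - h : ℝ) : ℂ) ≠ 0 := Complex.ofReal_ne_zero.mpr hb.ne'
  rw [hzv', Complex.ofReal_div]
  field_simp

end Hardy

/-! ### Boundary functions of Hardy functions -/

theorem inner_toLp_eq_integral {μ : Measure ℝ} {f g : ℝ → ℂ} (hf : MemLp f 2 μ)
    (hg : MemLp g 2 μ) :
    inner ℂ (hg.toLp g) (hf.toLp f) = ∫ x, f x * (starRingEnd ℂ) (g x) ∂μ := by
  rw [L2.inner_def]
  refine integral_congr_ae ?_
  filter_upwards [hf.coeFn_toLp, hg.coeFn_toLp] with x h1 h2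
  rw [h1, h2, RCLike.inner_apply]

/-- A bounded midpoint convex function on the positive half-line is nonincreasing. -/
theorem antitoneOn_of_midpoint_convex_of_bounded {N : ℝ → ℝ} {B : ℝ}
    (hN : ∀ h k : ℝ, 0 < h → 0 < k → 2 * N ((h + k) / 2) ≤ N h + N k)
    (hB : ∀ h : ℝ, 0 < h → N h ≤ B) : AntitoneOn N (Set.Ioi 0) := by
  intro h hh k hk hhk
  by_contra! hlt
  have hh : 0 < h := hh
  set s := k - h with hs
  have hs0 : 0 ≤ s := sub_nonneg.mpr hhk
  have hpos : ∀ n : ℕ, 0 < h + n * s := fun n => by positivity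
  -- Midpoint convexity makes the increments along an arithmetic progression nondecreasing, so one
  -- positive increment forces linear growth past `B`.
  have hinc : ∀ n : ℕ, N k - N h ≤ N (h + (n + 1 : ℕ) * s) - N (h + n * s) := by
    intro n
    induction n with
    | zero => simp [hs]
    | succ n ih =>
      have := hN _ _ (hpos n) (hpos (n + 1 + 1))
      have e : (h + n * s + (h + (n + 1 + 1 : ℕ) * s)) / 2 = h + (n + 1 : ℕ) * s := by
        push_cast; ring
      rw [e] at this
      linarith
  have hlin : ∀ n : ℕ, N h + n * (N k - N h) ≤ N (h + n * s) := by
    intro n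
    induction n with
    | zero => simp
    | succ n ih =>
      have := hinc n
      push_cast at this ⊢
      linarith
  obtain ⟨n, hn⟩ := exists_nat_gt ((B - N h) / (N k - N h))
  rw [div_lt_iff₀ (sub_pos.mpr hlt)] at hn
  linarith [hlin n, hB _ (hpos n)]

section Hardy
variable {f : ℂ → ℂ}

/-- Reflecting the second factor in the line at height `(h + k) / 2` and conjugating makes the
integrand the trace of an analytic function. On the middle line the two factors are conjugate, so
shifting there produces a squared norm. -/
theorem MemHardy.integral_line_mul_conj_line (hf : MemHardy f) {h k : ℝ} (hh : 0 < h)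
    (hhk : h ≤ k) :
    ∫ x : ℝ, f (x + h * Complex.I) * (starRingEnd ℂ) (f (x + k * Complex.I))
      = ((l2Norm volume (fun x : ℝ => f (x + ((h + k) / 2 : ℝ) * Complex.I)) ^ 2 : ℝ) : ℂ) := by
  obtain ⟨C, hC⟩ := hf.2
  rw [← integral_mul_conj_self (hf.memLp_line (by linarith))]
  set G : ℂ → ℂ := fun ζ => f ζ *
    (starRingEnd ℂ) (f ((starRingEnd ℂ) (ζ - (h + k : ℝ) * Complex.I))) with hG
  have hGx : ∀ x y : ℝ, G (x + y * Complex.I)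
      = f (x + y * Complex.I) * (starRingEnd ℂ) (f (x + (h + k - y : ℝ) * Complex.I)) := by
    intro x y
    simp only [hG]
    congr 3
    simp
    ring
  have e1 : ∀ x : ℝ, f (x + h * Complex.I) * (starRingEnd ℂ) (f (x + k * Complex.I))
      = G (x + h * Complex.I) := by
    intro x
    rw [hGx, add_sub_cancel_left]
  have e2 : ∀ x : ℝ, f (x + ((h + k) / 2 : ℝ) * Complex.I)
      * (starRingEnd ℂ) (f (x + ((h + k) / 2 : ℝ) * Complex.I))
      = G (x + ((h + k) / 2 : ℝ) * Complex.I) := by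
    intro x
    rw [hGx, sub_half]
  simp_rw [e1, e2]
  refine integral_horizontal_eq (R₀ := 0) (M := C * C) (by linarith) ?_ ?_
  · intro ζ h1 h2
    refine (hf.differentiableAt (hh.trans_le h1)).mul ?_
    have h3 : DifferentiableAt ℂ f ((starRingEnd ℂ) (ζ - (h + k : ℝ) * Complex.I)) := by
      refine hf.differentiableAt ?_
      simp
      linarith
    have h4 := h3.conj_conj
    rw [Complex.conj_conj] at h4
    exact DifferentiableAt.comp (f := fun ζ : ℂ => ζ - (h + k : ℝ) * Complex.I) ζ h4 (by fun_prop)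
  · intro y hy
    have hy0 : 0 < y := hh.trans_le hy.1
    have hy1 : 0 < h + k - y := by linarith [hy.2]
    simp_rw [hGx]
    refine (setLIntegral_le_lintegral _ _).trans ?_
    refine (lintegral_enorm_mul_le (hf.memLp_line hy0).1
      (memLp_conj (hf.memLp_line hy1)).1).trans ?_
    rw [ENNReal.coe_mul]
    refine mul_le_mul' (hC y hy0) ?_
    refine (eLpNorm_congr_norm_ae (Eventually.of_forall fun x => ?_)).trans_le (hC _ hy1)
    simp

/-- Distances between traces are thereby second differences of the squared norms: nonnegativity
gives midpoint convexity, and convergence of the norms gives the Cauchy property. -/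
theorem MemHardy.norm_toLp_line_sub_sq (hf : MemHardy f) {h k : ℝ} (hh : 0 < h) (hk : 0 < k) :
    ‖(hf.memLp_line hh).toLp _ - (hf.memLp_line hk).toLp _‖ ^ 2
      = l2Norm volume (fun x : ℝ => f (x + h * Complex.I)) ^ 2
        + l2Norm volume (fun x : ℝ => f (x + k * Complex.I)) ^ 2
        - 2 * l2Norm volume (fun x : ℝ => f (x + ((h + k) / 2 : ℝ) * Complex.I)) ^ 2 := by
  wlog hhk : h ≤ k generalizing h k
  · rw [norm_sub_rev, this hk hh (le_of_not_ge hhk), add_comm k h]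
    ring
  rw [norm_sub_sq (𝕜 := ℂ), inner_re_symm, inner_toLp_eq_integral,
    hf.integral_line_mul_conj_line hh hhk, Lp.norm_toLp, Lp.norm_toLp]
  simp only [l2Norm, RCLike.re_to_complex, Complex.ofReal_re]
  ring

/-- Every function of the Hardy space has a boundary function. -/
theorem MemHardy.exists_hasBoundaryData (hf : MemHardy f) :
    ∃ g : ℝ → ℂ, HasBoundaryData f g := by
  obtain ⟨C, hC⟩ := hf.exists_l2Norm_le
  set N : ℝ → ℝ := fun h => l2Norm volume (fun x : ℝ => f (x + h * Complex.I)) ^ 2 with hN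
  have hNB : ∀ h : ℝ, 0 < h → N h ≤ C ^ 2 := fun h hh =>
    pow_le_pow_left₀ l2Norm_nonneg (hC h hh) 2
  have hdist : ∀ (h k : ℝ) (hh : 0 < h) (hk : 0 < k),
      ‖(hf.memLp_line hh).toLp _ - (hf.memLp_line hk).toLp _‖ ^ 2
        = N h + N k - 2 * N ((h + k) / 2) := fun h k hh hk => hf.norm_toLp_line_sub_sq hh hk
  have hanti : AntitoneOn N (Set.Ioi 0) := by
    refine antitoneOn_of_midpoint_convex_of_bounded (B := C ^ 2) (fun h k hh hk => ?_) hNB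
    have := sq_nonneg ‖(hf.memLp_line hh).toLp _ - (hf.memLp_line hk).toLp _‖
    rw [hdist h k hh hk] at this
    linarith
  have hbdd : BddAbove (N '' Set.Ioi 0) := ⟨C ^ 2, by rintro _ ⟨h, hh, rfl⟩; exact hNB h hh⟩
  have hne : (N '' Set.Ioi 0).Nonempty := ⟨N 1, 1, by simp, rfl⟩
  set Φ : ℝ → Lp ℂ 2 (volume : Measure ℝ) := fun h =>
    if hh : 0 < h then (hf.memLp_line hh).toLp _ else 0 with hΦ
  have hΦe : ∀ h (hh : 0 < h), Φ h = (hf.memLp_line hh).toLp _ := fun h hh => dif_pos hh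
  have hcauchy : Cauchy ((𝓝[>] (0 : ℝ)).map Φ) := by
    rw [Metric.cauchy_iff]
    refine ⟨inferInstance, fun ε hε => ?_⟩
    -- Since `N` is nonincreasing, it lies within `ε² / 4` of its supremum at all heights up to
    -- `h₀`, so the second difference there is at most `ε² / 2`.
    obtain ⟨_, ⟨h₀, hh₀, rfl⟩, hlt⟩ := exists_lt_of_lt_csSup hne
      (sub_lt_self (sSup (N '' Set.Ioi 0)) (show 0 < ε ^ 2 / 4 by positivity))
    have hh₀ : 0 < h₀ := hh₀
    refine ⟨Φ '' Set.Ioo 0 h₀, image_mem_map (Ioo_mem_nhdsGT hh₀), ?_⟩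
    rintro _ ⟨h, hh, rfl⟩ _ ⟨k, hk, rfl⟩
    rw [hΦe h hh.1, hΦe k hk.1, dist_eq_norm]
    refine lt_of_pow_lt_pow_left₀ 2 hε.le ?_
    rw [hdist h k hh.1 hk.1]
    have h1 := le_csSup hbdd (Set.mem_image_of_mem N hh.1)
    have h2 := le_csSup hbdd (Set.mem_image_of_mem N hk.1)
    have hm0 : 0 < (h + k) / 2 := by linarith [hh.1, hk.1]
    have h3 := hanti (Set.mem_Ioi.mpr hm0) (Set.mem_Ioi.mpr hh₀) (by linarith [hh.2, hk.2])
    have : 0 < ε ^ 2 := by positivity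
    linarith
  obtain ⟨g, hg⟩ := cauchy_map_iff_exists_tendsto.mp hcauchy
  refine ⟨g, Lp.memLp g, ?_⟩
  have h0 : Tendsto (fun h => edist (Φ h) g) (𝓝[>] 0) (𝓝 0) := tendsto_iff_edist_tendsto_0.mp hg
  refine h0.congr' ?_
  filter_upwards [self_mem_nhdsWithin] with h hh
  have hh : 0 < h := hh
  rw [hΦe h hh, Lp.edist_def]
  refine eLpNorm_congr_ae ?_
  filter_upwards [(hf.memLp_line hh).coeFn_toLp] with x hx
  rw [Pi.sub_apply, hx]

theorem MemHardy.hasBoundaryData (hf : MemHardy f) : HasBoundaryData f (boundaryData f) := by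
  unfold boundaryData
  rw [dif_pos hf.exists_hasBoundaryData]
  exact hf.exists_hasBoundaryData.choose_spec

theorem MemHardy.eventually_memLp_line (hf : MemHardy f) :
    ∀ᶠ h : ℝ in 𝓝[>] 0, MemLp (fun x : ℝ => f (x + h * Complex.I)) 2 volume := by
  filter_upwards [self_mem_nhdsWithin] with h hh using hf.memLp_line hh

/-- Cauchy's formula for the boundary function, at a point of the upper half-plane. -/
theorem MemHardy.integral_boundary_mul_inv (hf : MemHardy f) {g : ℝ → ℂ}
    (hg : HasBoundaryData f g) {z : ℂ} (hz : 0 < z.im) :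
    ∫ x : ℝ, g x * ((x : ℂ) - z)⁻¹ = 2 * Real.pi * Complex.I * f z := by
  have h1 := tendsto_integral_mul hf.eventually_memLp_line hg.1 (memLp_inv_ofReal_sub hz.ne') hg.2
  have h2 : Tendsto (fun h : ℝ => 2 * Real.pi * Complex.I * f (z + h * Complex.I)) (𝓝[>] 0)
      (𝓝 (2 * Real.pi * Complex.I * f z)) := by
    have h3 : ContinuousAt (fun h : ℝ => f (z + h * Complex.I)) 0 := by
      refine ContinuousAt.comp (f := fun h : ℝ => z + h * Complex.I) ?_ (by fun_prop)
      simpa using (hf.differentiableAt hz).continuousAt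
    have h4 := h3.tendsto
    simp only [Complex.ofReal_zero, zero_mul, add_zero] at h4
    exact (h4.mono_left nhdsWithin_le_nhds).const_mul _
  refine tendsto_nhds_unique (h1.congr' ?_) h2
  filter_upwards [self_mem_nhdsWithin] with h hh
  have hh : 0 < h := hh
  -- Raising the pole together with the line leaves the kernel `(x - z)⁻¹` independent of `h`.
  rw [← hf.integral_line_mul_inv hh (z := z + h * Complex.I) (by simpa using hz)]
  simp_rw [add_sub_add_right_eq_sub]

/-- The Cauchy integral of the boundary function vanishes in the lower half-plane. -/
theorem MemHardy.integral_boundary_mul_inv_eq_zero (hf : MemHardy f) {g : ℝ → ℂ}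
    (hg : HasBoundaryData f g) {w : ℂ} (hw : w.im < 0) :
    ∫ x : ℝ, g x * ((x : ℂ) - w)⁻¹ = 0 := by
  have h1 := tendsto_integral_mul hf.eventually_memLp_line hg.1 (memLp_inv_ofReal_sub hw.ne) hg.2
  refine tendsto_nhds_unique (h1.congr' ?_) tendsto_const_nhds
  filter_upwards [self_mem_nhdsWithin] with h hh
  have hh : 0 < h := hh
  rw [← hf.integral_line_mul_inv_eq_zero hh (w := w + h * Complex.I) (by simpa using hw)]
  simp_rw [add_sub_add_right_eq_sub]

theorem HasBoundaryData.ae_eq {g g' : ℝ → ℂ} (hf : MemHardy f) (hg : HasBoundaryData f g)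
    (hg' : HasBoundaryData f g') : g =ᵐ[volume] g' := by
  have h0 : eLpNorm (fun x => g x - g' x) 2 volume = 0 := by
    have h1 := hg.2.add hg'.2
    rw [add_zero] at h1
    refine le_antisymm (ge_of_tendsto h1 ?_) bot_le
    filter_upwards [hf.eventually_memLp_line] with h hh
    have e : (fun x => g x - g' x) = (fun x : ℝ => f (x + h * Complex.I) - g' x)
        - fun x : ℝ => f (x + h * Complex.I) - g x := by
      ext x; simp
    rw [e, add_comm]
    exact eLpNorm_sub_le (hh.sub hg'.1).1 (hh.sub hg.1).1 (by norm_num)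
  have h2 := (eLpNorm_eq_zero_iff (hg.1.sub hg'.1).1 (by norm_num)).mp h0
  filter_upwards [h2] with x hx
  exact sub_eq_zero.mp hx

end Hardy

/-! ### The Cauchy transform of a function on the interval -/

instance : IsFiniteMeasure intervalMeasure := by
  unfold intervalMeasure
  infer_instance

theorem intervalMeasure_le : intervalMeasure ≤ volume := Measure.restrict_le_self

theorem ae_intervalMeasure_abs_lt : ∀ᵐ y : ℝ ∂intervalMeasure, |y| < 1 := by
  unfold intervalMeasure
  filter_upwards [ae_restrict_mem measurableSet_Ioo] with y hy
  exact abs_lt.mpr hy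

theorem l2Norm_intervalMeasure_le {g : ℝ → ℂ} (hg : MemLp g 2 volume) :
    l2Norm intervalMeasure g ≤ l2Norm volume g :=
  ENNReal.toReal_mono hg.2.ne (eLpNorm_mono_measure _ intervalMeasure_le)

/-- The Cauchy transform of a function on `(-1, 1)`, normalized so that its boundary function is
the projection onto the Hardy space. -/
noncomputable def cauchyTransform (u : ℝ → ℂ) (ζ : ℂ) : ℂ :=
  Complex.I / (2 * (Real.pi : ℂ)) * ∫ y, u y / (ζ - (y : ℂ)) ∂intervalMeasure

/-- On `Im ζ ≥ h` the Cauchy kernels with poles in `[-1, 1]` are comparable to the one with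
pole `0`. -/
theorem norm_inv_sub_le {h : ℝ} (hh : 0 < h) {ζ : ℂ} (hζ : h ≤ ζ.im) {y : ℝ} (hy : |y| < 1) :
    ‖(ζ - y)⁻¹‖ ≤ (1 + 1 / h) * ‖ζ⁻¹‖ := by
  have h1 : h ≤ ‖ζ - y‖ := by
    have h0 := Complex.abs_im_le_norm (ζ - y)
    simp only [Complex.sub_im, Complex.ofReal_im, sub_zero] at h0
    exact hζ.trans ((le_abs_self _).trans h0)
  have h2 : h ≤ ‖ζ‖ := hζ.trans ((le_abs_self _).trans (Complex.abs_im_le_norm ζ))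
  have h3 : ‖ζ‖ ≤ ‖ζ - y‖ + 1 := by
    have := norm_add_le (ζ - y) (y : ℂ)
    rw [sub_add_cancel, Complex.norm_real, Real.norm_eq_abs] at this
    linarith
  have h4 : 1 ≤ ‖ζ - y‖ / h := (one_le_div hh).mpr h1
  rw [norm_inv, norm_inv, ← div_eq_mul_inv, ← one_div,
    div_le_div_iff₀ (hh.trans_le h1) (hh.trans_le h2)]
  have : (1 + 1 / h) * ‖ζ - y‖ = ‖ζ - y‖ + ‖ζ - y‖ / h := by ring
  linarith

section Cauchy
variable {u : ℝ → ℂ}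

theorem integrable_of_memLp_interval (hu : MemLp u 2 intervalMeasure) :
    Integrable u intervalMeasure := hu.integrable (by norm_num)

theorem aestronglyMeasurable_div_sub (hu : AEStronglyMeasurable u intervalMeasure) (ζ : ℂ) :
    AEStronglyMeasurable (fun y : ℝ => u y / (ζ - y)) intervalMeasure := by
  simp_rw [div_eq_mul_inv]
  refine hu.mul (Measurable.aestronglyMeasurable ?_)
  exact (measurable_const.sub Complex.measurable_ofReal).inv

theorem differentiableAt_cauchyTransform (hu : MemLp u 2 intervalMeasure) {ζ : ℂ}
    (hζ : 0 < ζ.im) : DifferentiableAt ℂ (cauchyTransform u) ζ := by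
  have hui := integrable_of_memLp_interval hu
  have hball : ∀ w ∈ Metric.ball ζ (ζ.im / 2), ∀ y : ℝ, ζ.im / 2 ≤ ‖w - y‖ := by
    intro w hw y
    have h1 := Complex.abs_im_le_norm (w - ζ)
    have h2 : ‖w - ζ‖ < ζ.im / 2 := by simpa [dist_eq_norm] using hw
    have h3 := Complex.abs_im_le_norm (w - y)
    simp only [Complex.sub_im, Complex.ofReal_im, sub_zero] at h1 h3
    have := neg_abs_le (w.im - ζ.im)
    have := le_abs_self w.im
    linarith
  have h := hasDerivAt_integral_of_dominated_loc_of_deriv_le (μ := intervalMeasure) (𝕜 := ℂ)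
    (F := fun w y => u y / (w - (y : ℂ))) (F' := fun w y => -u y / (w - (y : ℂ)) ^ 2)
    (x₀ := ζ) (s := Metric.ball ζ (ζ.im / 2)) (bound := fun y => ‖u y‖ * (ζ.im / 2)⁻¹ ^ 2)
    (Metric.ball_mem_nhds _ (half_pos hζ))
    (Eventually.of_forall fun w => aestronglyMeasurable_div_sub hu.1 w) ?_ ?_ ?_ ?_ ?_
  · exact (h.2.differentiableAt).const_mul _
  · refine (hui.mul_const ((ζ.im / 2)⁻¹ : ℂ)).mono (aestronglyMeasurable_div_sub hu.1 ζ)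
      (Eventually.of_forall fun y => ?_)
    have h1 := hball ζ (Metric.mem_ball_self (half_pos hζ)) y
    rw [norm_div, norm_mul, div_eq_mul_inv]
    refine mul_le_mul_of_nonneg_left ?_ (norm_nonneg _)
    have e : ‖((ζ.im / 2 : ℂ))⁻¹‖ = (ζ.im / 2)⁻¹ := by
      rw [norm_inv, norm_div, Complex.norm_real, Real.norm_eq_abs, abs_of_pos hζ]
      simp
    rw [e]
    exact inv_anti₀ (half_pos hζ) h1
  · simp_rw [div_eq_mul_inv]
    refine hu.1.neg.mul (Measurable.aestronglyMeasurable ?_)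
    exact ((measurable_const.sub Complex.measurable_ofReal).pow_const 2).inv
  · refine Eventually.of_forall fun y w hw => ?_
    have h1 := hball w hw y
    rw [norm_div, norm_neg, norm_pow, div_eq_mul_inv, ← inv_pow]
    gcongr
  · exact hui.norm.mul_const _
  · refine Eventually.of_forall fun y w hw => ?_
    have h1 : w - (y : ℂ) ≠ 0 := norm_pos_iff.mp ((half_pos hζ).trans_le (hball w hw y))
    have h2 := ((hasDerivAt_id w).sub_const (y : ℂ)).inv h1
    have h3 : u y * (-1 / (id w - (y : ℂ)) ^ 2) = -u y / (w - (y : ℂ)) ^ 2 := by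
      rw [id]
      ring
    rw [← h3]
    exact h2.const_mul (u y)

/-- The constant blows up as `h → 0`. This crude decay only places the transform in `H²` above each
positive height, which is enough to use Cauchy's formula on the way to the uniform bound. -/
theorem norm_cauchyTransform_le (hu : MemLp u 2 intervalMeasure) {h : ℝ} (hh : 0 < h) {ζ : ℂ}
    (hζ : h ≤ ζ.im) :
    ‖cauchyTransform u ζ‖ ≤
      1 / (2 * Real.pi) * ((∫ y, ‖u y‖ ∂intervalMeasure) * (1 + 1 / h)) * ‖ζ⁻¹‖ := by
  unfold cauchyTransform
  have e : ‖Complex.I / (2 * (Real.pi : ℂ))‖ = 1 / (2 * Real.pi) := by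
    rw [norm_div, Complex.norm_I, norm_mul, Complex.norm_real, Real.norm_eq_abs,
      abs_of_pos Real.pi_pos, Complex.norm_ofNat]
  rw [norm_mul, e, mul_assoc]
  refine mul_le_mul_of_nonneg_left ?_ (by positivity)
  refine (norm_integral_le_of_norm_le
    ((integrable_of_memLp_interval hu).norm.mul_const ((1 + 1 / h) * ‖ζ⁻¹‖)) ?_).trans_eq ?_
  · filter_upwards [ae_intervalMeasure_abs_lt] with y hy
    rw [div_eq_mul_inv, norm_mul]
    exact mul_le_mul_of_nonneg_left (norm_inv_sub_le hh hζ hy) (norm_nonneg _)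
  · rw [integral_mul_const]
    ring

theorem continuous_cauchyTransform_line (hu : MemLp u 2 intervalMeasure) {h : ℝ} (hh : 0 < h) :
    Continuous fun x : ℝ => cauchyTransform u (x + h * Complex.I) := by
  rw [continuous_iff_continuousAt]
  intro x
  exact ContinuousAt.comp (f := fun x : ℝ => (x : ℂ) + h * Complex.I)
    (differentiableAt_cauchyTransform hu (by simpa using hh)).continuousAt (by fun_prop)

theorem eLpNorm_cauchyTransform_line_le (hu : MemLp u 2 intervalMeasure) {h₀ : ℝ} (hh : 0 < h₀) :
    ∃ A : NNReal, ∀ h : ℝ, h₀ ≤ h →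
      eLpNorm (fun x : ℝ => cauchyTransform u (x + h * Complex.I)) 2 volume ≤ A := by
  set c : ℝ := 1 / (2 * Real.pi) * ((∫ y, ‖u y‖ ∂intervalMeasure) * (1 + 1 / h₀)) with hc
  have hne : ((0 : ℂ) - h₀ * Complex.I).im ≠ 0 := by simpa using hh.ne'
  have hm := (memLp_inv_ofReal_sub hne).const_mul (c : ℂ)
  refine ⟨(eLpNorm (fun x : ℝ => (c : ℂ) * ((x : ℂ) - (0 - h₀ * Complex.I))⁻¹) 2
    volume).toNNReal, fun h hle => ?_⟩
  rw [ENNReal.coe_toNNReal hm.2.ne]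
  refine eLpNorm_mono fun x => ?_
  have h1 := norm_cauchyTransform_le hu hh (ζ := x + h * Complex.I) (by simpa using hle)
  have h2 := norm_inv_line_le (w := 0) (by simpa using hh) hle x
  have hc0 : 0 ≤ c := by positivity
  rw [norm_mul, Complex.norm_real, Real.norm_eq_abs, abs_of_nonneg hc0]
  refine h1.trans (mul_le_mul_of_nonneg_left ?_ hc0)
  rwa [sub_zero] at h2

theorem memLp_cauchyTransform_line (hu : MemLp u 2 intervalMeasure) {h : ℝ} (hh : 0 < h) :
    MemLp (fun x : ℝ => cauchyTransform u (x + h * Complex.I)) 2 volume := by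
  obtain ⟨A, hA⟩ := eLpNorm_cauchyTransform_line_le hu hh
  exact ⟨(continuous_cauchyTransform_line hu hh).aestronglyMeasurable,
    (hA h le_rfl).trans_lt ENNReal.coe_lt_top⟩

/-- Above any positive height the Cauchy transform belongs to the Hardy space. -/
theorem memHardy_cauchyTransform_shift (hu : MemLp u 2 intervalMeasure) {δ : ℝ} (hδ : 0 < δ) :
    MemHardy fun ζ => cauchyTransform u (ζ + δ * Complex.I) := by
  refine ⟨fun ζ hζ => ?_, ?_⟩
  · have hζ : 0 < ζ.im := hζ
    refine DifferentiableAt.differentiableWithinAt ?_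
    refine DifferentiableAt.comp (f := fun ζ : ℂ => ζ + δ * Complex.I) ζ
      (differentiableAt_cauchyTransform hu ?_) (by fun_prop)
    simp
    linarith
  · obtain ⟨A, hA⟩ := eLpNorm_cauchyTransform_line_le hu hδ
    refine ⟨A, fun y hy => ?_⟩
    convert hA (y + δ) (by linarith) using 3
    push_cast
    ring_nf

/-- Fubini: conjugating the kernel `(x + ih - y)⁻¹` moves its pole to `y + ih`, so the adjoint of
the transform on a line is the Cauchy integral of `φ` evaluated above the interval. -/
theorem integral_mul_conj_cauchyTransform_line (hu : MemLp u 2 intervalMeasure) {φ : ℝ → ℂ}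
    (hφ : MemLp φ 2 volume) {h : ℝ} (hh : 0 < h) :
    ∫ x : ℝ, φ x * (starRingEnd ℂ) (cauchyTransform u (x + h * Complex.I))
      = ∫ y : ℝ, (2 * Real.pi * Complex.I)⁻¹ * (∫ x : ℝ, φ x * ((x : ℂ) - (y + h * Complex.I))⁻¹)
          * (starRingEnd ℂ) (u y) ∂intervalMeasure := by
  have hui := integrable_of_memLp_interval hu
  have hne : (h * Complex.I : ℂ).im ≠ 0 := by simpa using hh.ne'
  have hprod : Integrable (Function.uncurry fun (x y : ℝ) =>
      φ x * ((x : ℂ) - (y + h * Complex.I))⁻¹ * (starRingEnd ℂ) (u y))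
      (volume.prod intervalMeasure) := by
    have h1 : Integrable (fun p : ℝ × ℝ => (φ p.1 * ((p.1 : ℂ) - h * Complex.I)⁻¹) *
        (((1 + 1 / h : ℝ) : ℂ) * u p.2)) (volume.prod intervalMeasure) :=
      (integrable_mul_of_memLp hφ (memLp_inv_ofReal_sub hne)).mul_prod (hui.const_mul _)
    refine h1.mono ?_ ?_
    · refine ((hφ.1.comp_fst).mul (Measurable.aestronglyMeasurable ?_)).mul ?_
      · fun_prop
      · exact Complex.continuous_conj.comp_aestronglyMeasurable hu.1.comp_snd
    · have h2 : ∀ᵐ p : ℝ × ℝ ∂(volume.prod intervalMeasure), |p.2| < 1 :=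
        Measure.quasiMeasurePreserving_snd.ae ae_intervalMeasure_abs_lt
      filter_upwards [h2] with p hp
      have h3 := norm_inv_sub_le hh (ζ := p.1 + h * Complex.I) (by simp) hp
      have e1 : ‖((p.1 : ℂ) - (p.2 + h * Complex.I))⁻¹‖ = ‖((p.1 : ℂ) + h * Complex.I - p.2)⁻¹‖ := by
        rw [norm_inv, norm_inv, ← Complex.norm_conj]
        congr 2
        simp
        ring
      have e2 : ‖((p.1 : ℂ) - h * Complex.I)⁻¹‖ = ‖((p.1 : ℂ) + h * Complex.I)⁻¹‖ := by
        rw [norm_inv, norm_inv, ← Complex.norm_conj]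
        congr 2
        simp
      simp only [Function.uncurry, norm_mul, e1, e2, Complex.norm_conj, Complex.norm_real,
        Real.norm_eq_abs]
      rw [abs_of_nonneg (by positivity : 0 ≤ 1 + 1 / h)]
      calc ‖φ p.1‖ * ‖((p.1 : ℂ) + h * Complex.I - p.2)⁻¹‖ * ‖u p.2‖
          ≤ ‖φ p.1‖ * ((1 + 1 / h) * ‖((p.1 : ℂ) + h * Complex.I)⁻¹‖) * ‖u p.2‖ := by gcongr
        _ = _ := by ring
  have hswap := integral_integral_swap hprod
  have hl : ∀ x : ℝ, φ x * (starRingEnd ℂ) (cauchyTransform u (x + h * Complex.I))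
      = (2 * Real.pi * Complex.I)⁻¹ * ∫ y : ℝ, φ x * ((x : ℂ) - (y + h * Complex.I))⁻¹
          * (starRingEnd ℂ) (u y) ∂intervalMeasure := by
    intro x
    have e1 : (∫ y : ℝ, φ x * ((x : ℂ) - (y + h * Complex.I))⁻¹ * (starRingEnd ℂ) (u y)
        ∂intervalMeasure) = φ x * (starRingEnd ℂ)
          (∫ y : ℝ, u y / ((x : ℂ) + h * Complex.I - y) ∂intervalMeasure) := by
      rw [← integral_conj, ← integral_const_mul]
      congr 1 with y
      have e3 : (starRingEnd ℂ) ((x : ℂ) + h * Complex.I - y) = x - (y + h * Complex.I) := by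
        simp
        ring
      rw [map_div₀, e3]
      ring
    have e2 : (starRingEnd ℂ) (Complex.I / (2 * (Real.pi : ℂ))) = (2 * Real.pi * Complex.I)⁻¹ := by
      have : (Real.pi : ℂ) ≠ 0 := Complex.ofReal_ne_zero.mpr Real.pi_ne_zero
      simp only [map_div₀, Complex.conj_I, map_mul, Complex.conj_ofReal, map_ofNat]
      field_simp
      simp
    rw [e1, cauchyTransform, map_mul, e2]
    ring
  simp_rw [hl]
  rw [integral_const_mul, hswap, ← integral_const_mul]
  congr 1 with y
  rw [integral_mul_const]
  ring

theorem l2Norm_cauchyTransform_line_sq_le (hu : MemLp u 2 intervalMeasure) {h : ℝ} (hh : 0 < h) :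
    l2Norm volume (fun x : ℝ => cauchyTransform u (x + h * Complex.I)) ^ 2
      ≤ l2Norm volume (fun x : ℝ => cauchyTransform u (x + (2 * h : ℝ) * Complex.I))
        * l2Norm intervalMeasure u := by
  have h2 : 0 < 2 * h := by linarith
  have hF := memLp_cauchyTransform_line hu hh
  have hF2 := memLp_cauchyTransform_line hu h2
  have h1 : ((l2Norm volume (fun x : ℝ => cauchyTransform u (x + h * Complex.I)) ^ 2 : ℝ) : ℂ)
      = ∫ y : ℝ, cauchyTransform u (y + (2 * h : ℝ) * Complex.I) * (starRingEnd ℂ) (u y)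
          ∂intervalMeasure := by
    rw [← integral_mul_conj_self hF, integral_mul_conj_cauchyTransform_line hu hF hh]
    congr 1 with y
    -- So far the transform is in `H²` only after an upward shift. Shifting by `h / 2` and using
    -- height `h / 2` and the point `y + (3h/2)i` gives the line at height `h` and the value at
    -- height `2h`.
    have hc := (memHardy_cauchyTransform_shift hu (half_pos hh)).integral_line_mul_inv
      (half_pos hh) (z := y + (h + h / 2 : ℝ) * Complex.I) (by simp; linarith)
    have e1 : ∀ x : ℝ, (x : ℂ) + (h / 2 : ℝ) * Complex.I + (h / 2 : ℝ) * Complex.I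
        = x + h * Complex.I := fun x => by push_cast; ring
    have e2 : ∀ x : ℝ, (x : ℂ) + (h / 2 : ℝ) * Complex.I - (y + (h + h / 2 : ℝ) * Complex.I)
        = x - (y + h * Complex.I) := fun x => by push_cast; ring
    have e3 : (y : ℂ) + (h + h / 2 : ℝ) * Complex.I + (h / 2 : ℝ) * Complex.I
        = y + (2 * h : ℝ) * Complex.I := by push_cast; ring
    simp_rw [e1, e2, e3] at hc
    rw [hc, inv_mul_cancel_left₀]
    simp [Real.pi_ne_zero]
  have hle := norm_integral_mul_le (hF2.mono_measure intervalMeasure_le) (memLp_conj hu)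
  rw [← h1, Complex.norm_real, Real.norm_eq_abs, abs_of_nonneg (by positivity), l2Norm_conj] at hle
  exact hle.trans (mul_le_mul_of_nonneg_right (l2Norm_intervalMeasure_le hF2) l2Norm_nonneg)

/-- The previous estimate improves itself: with `S` the supremum of the norms at heights at least
`h`, finite by the crude bound, and `a` the norm of `u`, it gives `S² ≤ S a`. Hence `S ≤ a`, a bound
free of `h`. -/
theorem l2Norm_cauchyTransform_line_le (hu : MemLp u 2 intervalMeasure) {h : ℝ} (hh : 0 < h) :
    l2Norm volume (fun x : ℝ => cauchyTransform u (x + h * Complex.I))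
      ≤ l2Norm intervalMeasure u := by
  set N : ℝ → ℝ := fun k => l2Norm volume (fun x : ℝ => cauchyTransform u (x + k * Complex.I))
    with hN
  obtain ⟨A, hA⟩ := eLpNorm_cauchyTransform_line_le hu hh
  have hbdd : BddAbove (N '' Set.Ici h) :=
    ⟨A, by rintro _ ⟨k, hk, rfl⟩; exact ENNReal.toReal_le_coe_of_le_coe (hA k hk)⟩
  have hmem : ∀ k, h ≤ k → N k ≤ sSup (N '' Set.Ici h) := fun k hk =>
    le_csSup hbdd (Set.mem_image_of_mem N hk)
  refine (hmem h le_rfl).trans ?_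
  set S := sSup (N '' Set.Ici h) with hS
  set a := l2Norm intervalMeasure u with ha
  have ha0 : 0 ≤ a := l2Norm_nonneg
  by_contra! hlt
  have hS0 : 0 < S := ha0.trans_lt hlt
  have hsq : Real.sqrt (S * a) < S := by
    rw [Real.sqrt_lt' hS0]
    nlinarith
  obtain ⟨_, ⟨k, hk, rfl⟩, hk2⟩ := exists_lt_of_lt_csSup
    (show (N '' Set.Ici h).Nonempty from ⟨N h, h, Set.self_mem_Ici, rfl⟩) hsq
  have hk : h ≤ k := hk
  have h1 := l2Norm_cauchyTransform_line_sq_le hu (hh.trans_le hk)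
  have h2 : N k ^ 2 ≤ S * a :=
    h1.trans (mul_le_mul_of_nonneg_right (hmem (2 * k) (by linarith)) ha0)
  exact absurd (Real.le_sqrt_of_sq_le h2) (not_le.mpr hk2)

theorem memHardy_cauchyTransform (hu : MemLp u 2 intervalMeasure) :
    MemHardy (cauchyTransform u) := by
  refine ⟨fun ζ hζ => (differentiableAt_cauchyTransform hu hζ).differentiableWithinAt,
    (l2Norm intervalMeasure u).toNNReal, fun y hy => ?_⟩
  rw [← ENNReal.ofReal_toReal (memLp_cauchyTransform_line hu hy).2.ne]
  exact ENNReal.ofReal_le_ofReal (l2Norm_cauchyTransform_line_le hu hy)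

/-- The Cauchy transform is the adjoint of the restriction of boundary functions to `(-1, 1)`. -/
theorem integral_boundary_mul_conj_cauchyTransform (hu : MemLp u 2 intervalMeasure)
    {f : ℂ → ℂ} {g G : ℝ → ℂ} (hf : MemHardy f) (hg : HasBoundaryData f g)
    (hG : HasBoundaryData (cauchyTransform u) G) :
    ∫ x : ℝ, g x * (starRingEnd ℂ) (G x)
      = ∫ x : ℝ, g x * (starRingEnd ℂ) (u x) ∂intervalMeasure := by
  have hF := memHardy_cauchyTransform hu
  have h1 : Tendsto (fun h : ℝ => ∫ x : ℝ, (starRingEnd ℂ) (cauchyTransform u (x + h * Complex.I))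
      * g x) (𝓝[>] 0) (𝓝 (∫ x : ℝ, (starRingEnd ℂ) (G x) * g x)) := by
    refine tendsto_integral_mul (hF.eventually_memLp_line.mono fun h hh => memLp_conj hh)
      (memLp_conj hG.1) hg.1 (hG.2.congr fun h => ?_)
    refine eLpNorm_congr_norm_ae (Eventually.of_forall fun x => ?_)
    rw [← map_sub, Complex.norm_conj]
  have h2 : Tendsto (fun h : ℝ => ∫ x : ℝ, f (x + h * Complex.I) * (starRingEnd ℂ) (u x)
      ∂intervalMeasure) (𝓝[>] 0) (𝓝 (∫ x : ℝ, g x * (starRingEnd ℂ) (u x) ∂intervalMeasure)) := by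
    refine tendsto_integral_mul
      (hf.eventually_memLp_line.mono fun h hh => hh.mono_measure intervalMeasure_le)
      (hg.1.mono_measure intervalMeasure_le) (memLp_conj hu) ?_
    exact tendsto_of_tendsto_of_tendsto_of_le_of_le tendsto_const_nhds hg.2 (fun _ => bot_le)
      fun h => eLpNorm_mono_measure _ intervalMeasure_le
  simp_rw [mul_comm ((starRingEnd ℂ) _) (g _)] at h1
  refine tendsto_nhds_unique (h1.congr' ?_) h2
  filter_upwards [self_mem_nhdsWithin] with h hh
  have hh : 0 < h := hh
  rw [integral_mul_conj_cauchyTransform_line hu hg.1 hh]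
  congr 1 with y
  rw [hf.integral_boundary_mul_inv hg (z := y + h * Complex.I) (by simpa using hh),
    inv_mul_cancel_left₀]
  simp [Real.pi_ne_zero]

end Cauchy

/-! ### Almost everywhere boundary values and the principal value -/

/-- Either `k = 0` works, or `k` can be taken with `2^(k-1) h ≤ |t|`, and then the kernel is at most
`h / t²`. The Poisson kernel is thus dominated by a series of indicators of dyadic balls. -/
theorem exists_dyadic {h : ℝ} (hh : 0 < h) (t : ℝ) :
    ∃ k : ℕ, |t| ≤ 2 ^ k * h ∧ h / (t ^ 2 + h ^ 2) ≤ 4 / (4 ^ k * h) := by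
  by_cases ht : |t| ≤ h
  · refine ⟨0, by simpa using ht, ?_⟩
    rw [pow_zero, one_mul, div_le_div_iff₀ (by positivity) hh]
    nlinarith [sq_nonneg t]
  · push Not at ht
    obtain ⟨n, hn1, hn2⟩ := exists_nat_pow_near ((one_le_div hh).mpr ht.le) (one_lt_two (α := ℝ))
    rw [le_div_iff₀ hh] at hn1
    rw [div_lt_iff₀ hh] at hn2
    refine ⟨n + 1, hn2.le, ?_⟩
    have h1 : (2 ^ n * h) ^ 2 ≤ t ^ 2 := by
      rw [← sq_abs t]
      gcongr
    have h2 : (4 : ℝ) ^ n = (2 ^ n) ^ 2 := by rw [← pow_mul, mul_comm, pow_mul]; norm_num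
    rw [div_le_div_iff₀ (by positivity) (by positivity), pow_succ, h2]
    nlinarith [sq_nonneg h]

/-- At almost every point the Poisson means of the oscillation of an `L²` function vanish in the
limit. -/
theorem ae_tendsto_lintegral_poissonKernel {g : ℝ → ℂ} (hg : MemLp g 2 volume) :
    ∀ᵐ x : ℝ, Tendsto
      (fun h : ℝ => ∫⁻ y : ℝ, ENNReal.ofReal (h / ((x - y) ^ 2 + h ^ 2)) * ‖g y - g x‖ₑ)
      (𝓝[>] 0) (𝓝 0) := by
  have hloc : LocallyIntegrable g volume := hg.locallyIntegrable (by norm_num)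
  filter_upwards [IsUnifLocDoublingMeasure.ae_tendsto_average_norm_sub volume hloc 1] with x hx
  set M : ℝ → ℝ := fun r => ⨍ y in Metric.closedBall x r, ‖g y - g x‖ with hM
  have hM0 : Tendsto M (𝓝[>] 0) (𝓝 0) := by
    refine hx (fun _ => x) id tendsto_id ?_
    filter_upwards [self_mem_nhdsWithin] with r hr
    have hr : 0 < r := hr
    simpa using hr.le
  have hint : ∀ r : ℝ, IntegrableOn (fun y => ‖g y - g x‖) (Metric.closedBall x r) := fun r =>
    ((hloc.integrableOn_isCompact (isCompact_closedBall x r)).sub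
      (integrableOn_const (isCompact_closedBall x r).measure_lt_top.ne)).norm
  have hMr : ∀ r : ℝ, 0 < r → M r = (2 * r)⁻¹ * ∫ y in Metric.closedBall x r, ‖g y - g x‖ := by
    intro r hr
    simp only [hM]
    rw [setAverage_eq, measureReal_def, Real.volume_closedBall, ENNReal.toReal_ofReal (by linarith),
      smul_eq_mul]
  have hMnn : ∀ r : ℝ, 0 < r → 0 ≤ M r := fun r hr => by
    rw [hMr r hr]
    exact mul_nonneg (by positivity) (integral_nonneg fun _ => norm_nonneg _)
  have hsq : Integrable (fun y => ‖g y‖ ^ 2) :=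
    (memLp_two_iff_integrable_sq_norm hg.1).mp hg
  -- Small radii are controlled by the Lebesgue point property, large ones by `|g| ≤ 1 + |g|²` and
  -- the finite `L²` norm.
  obtain ⟨B, hB⟩ : ∃ B : ℝ, ∀ r : ℝ, 0 < r → M r ≤ B := by
    obtain ⟨η, hη, hη1⟩ := mem_nhdsGT_iff_exists_Ioo_subset.mp
      (hM0.eventually (gt_mem_nhds one_pos))
    have hη : 0 < η := hη
    have hI0 : 0 ≤ ∫ y, ‖g y‖ ^ 2 := integral_nonneg fun _ => by positivity
    refine ⟨1 + ‖g x‖ + (2 * η)⁻¹ * ∫ y, ‖g y‖ ^ 2, fun r hr => ?_⟩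
    by_cases hrη : r < η
    · have h1 : M r < 1 := hη1 ⟨hr, hrη⟩
      have : 0 ≤ (2 * η)⁻¹ * ∫ y, ‖g y‖ ^ 2 := by positivity
      linarith [norm_nonneg (g x)]
    · push Not at hrη
      have hcon : IntegrableOn (fun _ : ℝ => 1 + ‖g x‖) (Metric.closedBall x r) :=
        integrableOn_const (isCompact_closedBall x r).measure_lt_top.ne
      have h1 : ∫ y in Metric.closedBall x r, ‖g y - g x‖
          ≤ ∫ y in Metric.closedBall x r, ((1 + ‖g x‖) + ‖g y‖ ^ 2) := by
        refine integral_mono (hint r) (hcon.add hsq.integrableOn) fun y => ?_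
        have := norm_sub_le (g y) (g x)
        nlinarith [sq_nonneg (‖g y‖ - 1)]
      rw [integral_add hcon hsq.integrableOn, setIntegral_const, measureReal_def,
        Real.volume_closedBall, ENNReal.toReal_ofReal (by linarith), smul_eq_mul] at h1
      have h2 : ∫ y in Metric.closedBall x r, ‖g y‖ ^ 2 ≤ ∫ y, ‖g y‖ ^ 2 :=
        setIntegral_le_integral hsq (Eventually.of_forall fun _ => by positivity)
      rw [hMr r hr]
      calc (2 * r)⁻¹ * ∫ y in Metric.closedBall x r, ‖g y - g x‖
          ≤ (2 * r)⁻¹ * (2 * r * (1 + ‖g x‖) + ∫ y, ‖g y‖ ^ 2) := by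
            gcongr
            linarith
        _ = 1 + ‖g x‖ + (2 * r)⁻¹ * ∫ y, ‖g y‖ ^ 2 := by
            field_simp
        _ ≤ _ := by gcongr
  -- The weight is the kernel bound `4 / (4^k h)` times the ball length `2 · 2^k h`.
  have hT : Tendsto (fun h : ℝ => ∑' k : ℕ, 8 * (1 / 2 : ℝ) ^ k * M (2 ^ k * h)) (𝓝[>] 0)
      (𝓝 (∑' _ : ℕ, (0 : ℝ))) := by
    refine tendsto_tsum_of_dominated_convergence
      (bound := fun k : ℕ => 8 * (1 / 2 : ℝ) ^ k * B)
      ((summable_geometric_two.mul_left 8).mul_right B) (fun k => ?_) ?_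
    · have h1 : Tendsto (fun h : ℝ => (2 : ℝ) ^ k * h) (𝓝[>] 0) (𝓝[>] 0) := by
        refine tendsto_nhdsWithin_iff.mpr ⟨?_, ?_⟩
        · have : Tendsto (fun h : ℝ => (2 : ℝ) ^ k * h) (𝓝 0) (𝓝 (2 ^ k * 0)) :=
            tendsto_id.const_mul _
          rw [mul_zero] at this
          exact this.mono_left nhdsWithin_le_nhds
        · filter_upwards [self_mem_nhdsWithin] with h hh
          have hh : 0 < h := hh
          exact Set.mem_Ioi.mpr (by positivity)
      simpa only [mul_zero, Function.comp_def] using (hM0.comp h1).const_mul (8 * (1 / 2 : ℝ) ^ k)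
    · filter_upwards [self_mem_nhdsWithin] with h hh k
      have hh : 0 < h := hh
      have hk : 0 < 2 ^ k * h := by positivity
      rw [Real.norm_eq_abs, abs_of_nonneg (mul_nonneg (by positivity) (hMnn _ hk))]
      exact mul_le_mul_of_nonneg_left (hB _ hk) (by positivity)
  rw [tsum_zero] at hT
  have hT' := ENNReal.tendsto_ofReal hT
  rw [ENNReal.ofReal_zero] at hT'
  refine tendsto_of_tendsto_of_tendsto_of_le_of_le' tendsto_const_nhds hT'
    (Eventually.of_forall fun _ => bot_le) ?_
  filter_upwards [self_mem_nhdsWithin] with h hh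
  have hh : 0 < h := hh
  have hmeas : AEMeasurable (fun y => ‖g y - g x‖ₑ) volume :=
    (hg.1.sub aestronglyMeasurable_const).enorm
  have hsum : Summable fun k : ℕ => 8 * (1 / 2 : ℝ) ^ k * M (2 ^ k * h) := by
    refine Summable.of_nonneg_of_le (fun k => ?_) (fun k => ?_)
      ((summable_geometric_two.mul_left 8).mul_right B)
    · exact mul_nonneg (by positivity) (hMnn _ (by positivity))
    · exact mul_le_mul_of_nonneg_left (hB _ (by positivity)) (by positivity)
  rw [ENNReal.ofReal_tsum_of_nonneg
    (fun k => mul_nonneg (by positivity) (hMnn _ (by positivity))) hsum]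
  calc ∫⁻ y : ℝ, ENNReal.ofReal (h / ((x - y) ^ 2 + h ^ 2)) * ‖g y - g x‖ₑ
      ≤ ∫⁻ y : ℝ, ∑' k : ℕ, (Metric.closedBall x (2 ^ k * h)).indicator
          (fun y => ENNReal.ofReal (4 / (4 ^ k * h)) * ‖g y - g x‖ₑ) y := by
        refine lintegral_mono fun y => ?_
        obtain ⟨k, hk1, hk2⟩ := exists_dyadic hh (x - y)
        refine le_trans ?_ (ENNReal.le_tsum k)
        rw [Set.indicator_of_mem (by rwa [Metric.mem_closedBall, dist_comm, Real.dist_eq])]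
        gcongr
    _ = ∑' k : ℕ, ∫⁻ y in Metric.closedBall x (2 ^ k * h),
          ENNReal.ofReal (4 / (4 ^ k * h)) * ‖g y - g x‖ₑ := by
        rw [lintegral_tsum fun k => ((hmeas.const_mul _).indicator measurableSet_closedBall)]
        congr 1 with k
        rw [lintegral_indicator measurableSet_closedBall]
    _ = ∑' k : ℕ, ENNReal.ofReal (8 * (1 / 2 : ℝ) ^ k * M (2 ^ k * h)) := by
        congr 1 with k
        rw [lintegral_const_mul'' _ hmeas.restrict, hMr _ (by positivity)]
        have h1 : ∫⁻ y in Metric.closedBall x (2 ^ k * h), ‖g y - g x‖ₑ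
            = ENNReal.ofReal (∫ y in Metric.closedBall x (2 ^ k * h), ‖g y - g x‖) := by
          rw [ofReal_integral_eq_lintegral_ofReal (hint _)
            (Eventually.of_forall fun _ => norm_nonneg _)]
          congr 1 with y
          rw [ofReal_norm]
        rw [h1, ← ENNReal.ofReal_mul (by positivity)]
        congr 1
        have h4 : (4 : ℝ) ^ k = 2 ^ k * 2 ^ k := by rw [← mul_pow]; norm_num
        rw [h4, one_div, inv_pow]
        field_simp
        ring

/-- Integration of an `L²` function against kernels dominated by the Poisson kernel. -/
theorem ae_tendsto_integral_kernel {g : ℝ → ℂ} (hg : MemLp g 2 volume) {K : ℝ → ℝ → ℂ} {c A : ℂ}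
    (hKm : ∀ h : ℝ, 0 < h → Measurable (K h))
    (hK : ∀ h : ℝ, 0 < h → ∀ t : ℝ, ‖K h t‖ ≤ ‖c‖ * (h / (t ^ 2 + h ^ 2)))
    (hA : ∀ h : ℝ, 0 < h → ∫ t : ℝ, K h t = A) :
    ∀ᵐ x : ℝ, Tendsto (fun h : ℝ => ∫ y : ℝ, g y * K h (x - y)) (𝓝[>] 0) (𝓝 (g x * A)) := by
  filter_upwards [ae_tendsto_lintegral_poissonKernel hg] with x hx
  have hKi : ∀ h : ℝ, 0 < h → Integrable (K h) := by
    intro h hh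
    refine ((integrable_poissonKernel 0 hh).const_mul ‖c‖).mono' (hKm h hh).aestronglyMeasurable
      (Eventually.of_forall fun t => ?_)
    simpa using hK h hh t
  have hPb : ∀ h : ℝ, 0 < h → ∀ t : ℝ, h / (t ^ 2 + h ^ 2) ≤ 1 / h := fun h hh t => by
    rw [div_le_div_iff₀ (by positivity) hh]
    nlinarith [sq_nonneg t]
  have hK2 : ∀ h : ℝ, 0 < h → MemLp (fun y => K h (x - y)) 2 volume := by
    intro h hh
    have hm : AEStronglyMeasurable (fun y => K h (x - y)) volume :=
      ((hKm h hh).comp (measurable_const.sub measurable_id)).aestronglyMeasurable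
    rw [memLp_two_iff_integrable_sq_norm hm]
    refine (((hKi h hh).comp_sub_left x).norm.const_mul (‖c‖ * (1 / h))).mono' (hm.norm.pow 2)
      (Eventually.of_forall fun y => ?_)
    rw [Real.norm_eq_abs, abs_of_nonneg (by positivity), sq]
    refine mul_le_mul_of_nonneg_right ((hK h hh _).trans ?_) (norm_nonneg _)
    exact mul_le_mul_of_nonneg_left (hPb h hh _) (norm_nonneg _)
  rw [tendsto_iff_edist_tendsto_0]
  have hx' := ENNReal.Tendsto.const_mul (a := ‖c‖ₑ) hx (Or.inr enorm_ne_top)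
  rw [mul_zero] at hx'
  refine tendsto_of_tendsto_of_tendsto_of_le_of_le' tendsto_const_nhds hx'
    (Eventually.of_forall fun _ => bot_le) ?_
  filter_upwards [self_mem_nhdsWithin] with h hh
  have hh : 0 < h := hh
  -- The total mass `A` does not depend on `h`, so the error involves only the oscillation of `g` at
  -- `x`.
  have e : (∫ y : ℝ, g y * K h (x - y)) - g x * A = ∫ y : ℝ, (g y - g x) * K h (x - y) := by
    rw [← hA h hh, ← integral_sub_left_eq_self (K h) volume x, ← integral_const_mul,
      ← integral_sub (integrable_mul_of_memLp hg (hK2 h hh))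
        (((hKi h hh).comp_sub_left x).const_mul _)]
    congr 1 with y
    ring
  rw [edist_eq_enorm_sub, e, ← lintegral_const_mul' _ _ enorm_ne_top]
  refine (enorm_integral_le_lintegral_enorm _).trans (lintegral_mono fun y => ?_)
  rw [enorm_mul, mul_comm, ← mul_assoc]
  gcongr
  rw [← ofReal_norm, ← ofReal_norm, ← ENNReal.ofReal_mul (norm_nonneg _)]
  exact ENNReal.ofReal_le_ofReal (hK h hh _)

/-- A function of the Hardy space converges vertically to its boundary function almost
everywhere. -/
theorem MemHardy.ae_tendsto {f : ℂ → ℂ} (hf : MemHardy f) {g : ℝ → ℂ} (hg : HasBoundaryData f g) :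
    ∀ᵐ x : ℝ, Tendsto (fun h : ℝ => f (x + h * Complex.I)) (𝓝[>] 0) (𝓝 (g x)) := by
  have hpi : (Real.pi : ℂ) ≠ 0 := Complex.ofReal_ne_zero.mpr Real.pi_ne_zero
  have h1 := ae_tendsto_integral_kernel hg.1
    (K := fun h t => ((h / (t ^ 2 + h ^ 2) : ℝ) : ℂ)) (c := 1) (A := Real.pi)
    (fun h _ => by fun_prop) (fun h hh t => by
      rw [Complex.norm_real, Real.norm_eq_abs, abs_of_nonneg (by positivity)]
      simp) (fun h hh => by
      rw [integral_complex_ofReal]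
      congr 1
      simpa using integral_poissonKernel 0 hh)
  filter_upwards [h1] with x hx
  have h2 := hx.mul_const (Real.pi : ℂ)⁻¹
  rw [mul_inv_cancel_right₀ hpi] at h2
  refine h2.congr' ?_
  filter_upwards [self_mem_nhdsWithin] with h hh
  have hh : 0 < h := hh
  have hz := hf.integral_boundary_mul_inv hg (z := x + h * Complex.I) (by simpa using hh)
  have hw := hf.integral_boundary_mul_inv_eq_zero hg (w := x - h * Complex.I) (by simpa using hh)
  -- The Poisson kernel is a difference of Cauchy kernels with poles `x ± ih`. The lower one
  -- contributes nothing, so `f` is the Poisson integral of `g`.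
  have hd : ∫ y : ℝ, g y * ((h / ((x - y) ^ 2 + h ^ 2) : ℝ) : ℂ)
      = (2 * Complex.I)⁻¹ * ((∫ y : ℝ, g y * ((y : ℂ) - (x + h * Complex.I))⁻¹)
          - ∫ y : ℝ, g y * ((y : ℂ) - (x - h * Complex.I))⁻¹) := by
    have hne1 : (x + h * Complex.I : ℂ).im ≠ 0 := by simpa using hh.ne'
    have hne2 : (x - h * Complex.I : ℂ).im ≠ 0 := by simpa using hh.ne'
    rw [← integral_sub (integrable_mul_of_memLp hg.1 (memLp_inv_ofReal_sub hne1))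
      (integrable_mul_of_memLp hg.1 (memLp_inv_ofReal_sub hne2)), ← integral_const_mul]
    congr 1 with y
    have k1 := ofReal_sub_ne_zero hne1 y
    have k2 := ofReal_sub_ne_zero hne2 y
    have k3 : (((x - y) ^ 2 + h ^ 2 : ℝ) : ℂ)
        = ((y : ℂ) - (x + h * Complex.I)) * ((y : ℂ) - (x - h * Complex.I)) := by
      push_cast
      linear_combination (h : ℂ) ^ 2 * Complex.I_sq
    rw [Complex.ofReal_div, k3]
    field_simp
    ring
  rw [hd, hz, hw]
  field_simp
  ring

/-- The difference of the Cauchy kernel at height `h` and the truncated kernel of the principal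
value. -/
noncomputable def truncationKernel (h t : ℝ) : ℂ :=
  ((t : ℂ) + h * Complex.I)⁻¹ - if h < |t| then ((t : ℂ))⁻¹ else 0

theorem measurable_truncationKernel (h : ℝ) : Measurable (truncationKernel h) := by
  unfold truncationKernel
  refine Measurable.sub (by fun_prop) (Measurable.ite ?_ (by fun_prop) measurable_const)
  exact measurableSet_lt measurable_const (by fun_prop)

/-- For `|t| > h` the difference of inverses is `-ih / (t (t + ih))` with `|t + ih| ≤ 2|t|`;
otherwise only `(t + ih)⁻¹` remains, with `|t + ih| ≤ 2h`. -/
theorem norm_truncationKernel_le {h : ℝ} (hh : 0 < h) (t : ℝ) :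
    ‖truncationKernel h t‖ ≤ ‖(2 : ℂ)‖ * (h / (t ^ 2 + h ^ 2)) := by
  have hQ : 0 < t ^ 2 + h ^ 2 := by positivity
  have hn2 : ‖(t : ℂ) + h * Complex.I‖ ^ 2 = t ^ 2 + h ^ 2 := by
    rw [← Complex.normSq_eq_norm_sq, Complex.normSq_add_mul_I]
  have hnp : 0 < ‖(t : ℂ) + h * Complex.I‖ := by
    rcases (norm_nonneg ((t : ℂ) + h * Complex.I)).eq_or_lt with h0 | h0
    · rw [← h0] at hn2
      norm_num at hn2
      linarith
    · exact h0
  set n := ‖(t : ℂ) + h * Complex.I‖ with hn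
  rw [Complex.norm_ofNat, ← hn2, ← mul_div_assoc]
  unfold truncationKernel
  split_ifs with ht
  · have ht0 : 0 < |t| := hh.trans ht
    have htc : (t : ℂ) ≠ 0 := Complex.ofReal_ne_zero.mpr (abs_pos.mp ht0)
    have e : ((t : ℂ) + h * Complex.I)⁻¹ - (t : ℂ)⁻¹
        = -(h * Complex.I) / (t * ((t : ℂ) + h * Complex.I)) := by
      have := norm_pos_iff.mp hnp
      field_simp
      ring
    rw [e, norm_div, norm_neg, norm_mul, norm_mul, Complex.norm_I, Complex.norm_real,
      Complex.norm_real, Real.norm_eq_abs, Real.norm_eq_abs, abs_of_pos hh, mul_one, ← hn,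
      div_le_div_iff₀ (by positivity) (by positivity)]
    have h1 : n ≤ 2 * |t| := by
      refine le_of_sq_le_sq ?_ (by positivity)
      rw [hn2, mul_pow, sq_abs]
      have : h ^ 2 ≤ t ^ 2 := by rw [← sq_abs t]; gcongr
      linarith [sq_nonneg t]
    have : h * n * n ≤ h * n * (2 * |t|) := by gcongr
    linarith
  · push Not at ht
    rw [sub_zero, norm_inv, ← hn, ← one_div, div_le_div_iff₀ hnp (by positivity)]
    have h1 : n ≤ 2 * h := by
      refine le_of_sq_le_sq ?_ (by positivity)
      have : t ^ 2 ≤ h ^ 2 := by rw [← sq_abs t]; gcongr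
      rw [hn2]
      nlinarith
    nlinarith

/-- Adding the values at `t` and `-t` cancels the truncated kernel and leaves `-2i` times the
Poisson kernel. This mass is the source of the jump term `u / 2`. -/
theorem integral_truncationKernel {h : ℝ} (hh : 0 < h) :
    ∫ t : ℝ, truncationKernel h t = -(Real.pi * Complex.I) := by
  have hi : Integrable (truncationKernel h) := by
    refine ((integrable_poissonKernel 0 hh).const_mul ‖(2 : ℂ)‖).mono'
      (measurable_truncationKernel h).aestronglyMeasurable (Eventually.of_forall fun t => ?_)
    simpa using norm_truncationKernel_le hh t
  have h1 : (∫ t : ℝ, truncationKernel h t) + ∫ t : ℝ, truncationKernel h (-t)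
      = ∫ t : ℝ, (-2 * Complex.I) * ((h / ((t - 0) ^ 2 + h ^ 2) : ℝ) : ℂ) := by
    rw [← integral_add hi hi.comp_neg]
    congr 1 with t
    have hne : (-(h * Complex.I) : ℂ).im ≠ 0 := by simpa using hh.ne'
    have k1 : (t : ℂ) + h * Complex.I ≠ 0 := by simpa using ofReal_sub_ne_zero hne t
    have hne' : ((h * Complex.I) : ℂ).im ≠ 0 := by simpa using hh.ne'
    have k2 : (t : ℂ) - h * Complex.I ≠ 0 := ofReal_sub_ne_zero hne' t
    have k3 : (((t - 0) ^ 2 + h ^ 2 : ℝ) : ℂ)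
        = ((t : ℂ) + h * Complex.I) * ((t : ℂ) - h * Complex.I) := by
      push_cast
      linear_combination (h : ℂ) ^ 2 * Complex.I_sq
    have k4 : truncationKernel h t + truncationKernel h (-t)
        = ((t : ℂ) + h * Complex.I)⁻¹ - ((t : ℂ) - h * Complex.I)⁻¹ := by
      have e : ((-t : ℝ) : ℂ) + h * Complex.I = -((t : ℂ) - h * Complex.I) := by push_cast; ring
      unfold truncationKernel
      rw [e, inv_neg, abs_neg]
      split_ifs
      · push_cast
        rw [inv_neg]
        ring
      · ring
    rw [k4, Complex.ofReal_div, k3]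
    field_simp
    ring
  rw [integral_neg_eq_self, integral_const_mul, integral_complex_ofReal,
    integral_poissonKernel 0 hh] at h1
  linear_combination (1 / 2 : ℂ) * h1

theorem cauchyTransform_line_eq {u : ℝ → ℂ} (hu : MemLp u 2 intervalMeasure) (x : ℝ) {h : ℝ}
    (hh : 0 < h) :
    cauchyTransform u (x + h * Complex.I) = Complex.I / (2 * (Real.pi : ℂ)) *
      ((∫ y : ℝ, (Set.Ioo (-1 : ℝ) 1).indicator u y * truncationKernel h (x - y))
        + ∫ y in Set.Ioo (-1 : ℝ) 1 ∩ {y : ℝ | h < |x - y|}, u y / ((x : ℂ) - (y : ℂ))) := by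
  have hui := integrable_of_memLp_interval hu
  have hms : MeasurableSet {y : ℝ | h < |x - y|} :=
    measurableSet_lt measurable_const (by fun_prop)
  have hkm : ∀ ζ : ℂ, Measurable fun y : ℝ => (ζ - (y : ℂ))⁻¹ := fun ζ => by fun_prop
  have e1 : ∫ y in Set.Ioo (-1 : ℝ) 1 ∩ {y : ℝ | h < |x - y|}, u y / ((x : ℂ) - (y : ℂ))
      = ∫ y, u y * (if h < |x - y| then ((x : ℂ) - y)⁻¹ else 0) ∂intervalMeasure := by
    rw [Set.inter_comm, ← Measure.restrict_restrict hms, ← integral_indicator hms]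
    refine integral_congr_ae (Eventually.of_forall fun y => ?_)
    by_cases hy : h < |x - y|
    · simp [Set.indicator, hy, div_eq_mul_inv]
    · simp [Set.indicator, hy]
  have e2 : ∫ y : ℝ, (Set.Ioo (-1 : ℝ) 1).indicator u y * truncationKernel h (x - y)
      = ∫ y, u y * truncationKernel h (x - y) ∂intervalMeasure := by
    rw [intervalMeasure, ← integral_indicator measurableSet_Ioo]
    congr 1 with y
    rw [Set.indicator_mul_left]
  have i1 : Integrable (fun y => u y * (if h < |x - y| then ((x : ℂ) - y)⁻¹ else 0))
      intervalMeasure := by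
    refine hui.mul_bdd (c := 1 / h)
      (Measurable.ite hms (hkm x) measurable_const).aestronglyMeasurable
      (Eventually.of_forall fun y => ?_)
    split_ifs with hy
    · rw [norm_inv, ← Complex.ofReal_sub, Complex.norm_real, Real.norm_eq_abs, one_div]
      exact inv_anti₀ hh hy.le
    · simp [hh.le]
  have i2 : Integrable (fun y => u y * truncationKernel h (x - y)) intervalMeasure := by
    refine hui.mul_bdd (c := 2 / h)
      ((measurable_truncationKernel h).comp (measurable_const.sub measurable_id)
        ).aestronglyMeasurable (Eventually.of_forall fun y => ?_)
    refine (norm_truncationKernel_le hh _).trans ?_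
    rw [Complex.norm_ofNat, ← mul_div_assoc, div_le_div_iff₀ (by positivity) hh]
    nlinarith [sq_nonneg (x - y)]
  rw [e1, e2, ← integral_add i2 i1, cauchyTransform]
  congr 2 with y
  rw [truncationKernel, div_eq_mul_inv, ← mul_add]
  have e3 : ((x - y : ℝ) : ℂ) + h * Complex.I = x + h * Complex.I - y := by push_cast; ring
  rw [e3, Complex.ofReal_sub, sub_add_cancel]

/-- The principal value exists almost everywhere and is given by the boundary function of the
Cauchy transform. -/
theorem ae_hasPrincipalValue {u : ℝ → ℂ} (hu : MemLp u 2 intervalMeasure) {G : ℝ → ℂ}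
    (hG : HasBoundaryData (cauchyTransform u) G) :
    ∀ᵐ x ∂intervalMeasure,
      HasPrincipalValue u x (2 * Real.pi / Complex.I * (G x - u x / 2)) := by
  have hpi : (Real.pi : ℂ) ≠ 0 := Complex.ofReal_ne_zero.mpr Real.pi_ne_zero
  have hut : MemLp ((Set.Ioo (-1 : ℝ) 1).indicator u) 2 volume :=
    (memLp_indicator_iff_restrict measurableSet_Ioo).mpr hu
  have h1 := ae_tendsto_integral_kernel hut (K := truncationKernel)
    (fun h _ => measurable_truncationKernel h) (fun h hh => norm_truncationKernel_le hh)
    (fun h hh => integral_truncationKernel hh)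
  have h2 := (memHardy_cauchyTransform hu).ae_tendsto hG
  unfold intervalMeasure
  filter_upwards [ae_restrict_of_ae h1, ae_restrict_of_ae h2,
    ae_restrict_mem measurableSet_Ioo] with x hx1 hx2 hx
  rw [Set.indicator_of_mem hx] at hx1
  have h3 := (hx2.const_mul (2 * Real.pi / Complex.I)).sub hx1
  have e : 2 * Real.pi / Complex.I * G x - u x * -(Real.pi * Complex.I)
      = 2 * Real.pi / Complex.I * (G x - u x / 2) := by
    rw [Complex.div_I]
    ring
  rw [e] at h3
  refine h3.congr' ?_
  filter_upwards [self_mem_nhdsWithin] with h hh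
  have hh : 0 < h := hh
  rw [cauchyTransform_line_eq hu x hh]
  field_simp
  ring

/-! ### Linearity of boundary functions -/

section Linear
variable {f f' : ℂ → ℂ} {g g' : ℝ → ℂ}

theorem MemHardy.add (hf : MemHardy f) (hf' : MemHardy f') :
    MemHardy fun ζ => f ζ + f' ζ := by
  obtain ⟨C, hC⟩ := hf.2
  obtain ⟨C', hC'⟩ := hf'.2
  refine ⟨hf.1.add hf'.1, C + C', fun y hy => ?_⟩
  rw [ENNReal.coe_add]
  exact (eLpNorm_add_le (hf.memLp_line hy).1 (hf'.memLp_line hy).1 (by norm_num)).trans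
    (add_le_add (hC y hy) (hC' y hy))

theorem MemHardy.const_mul (hf : MemHardy f) (c : ℂ) : MemHardy fun ζ => c * f ζ := by
  obtain ⟨C, hC⟩ := hf.2
  refine ⟨hf.1.const_mul c, ‖c‖₊ * C, fun y hy => ?_⟩
  rw [ENNReal.coe_mul]
  exact (eLpNorm_const_smul_le (c := c)).trans (mul_le_mul_right (hC y hy) _)

theorem HasBoundaryData.add (hf : MemHardy f) (hf' : MemHardy f') (hg : HasBoundaryData f g)
    (hg' : HasBoundaryData f' g') :
    HasBoundaryData (fun ζ => f ζ + f' ζ) fun x => g x + g' x := by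
  refine ⟨hg.1.add hg'.1, ?_⟩
  have h1 := hg.2.add hg'.2
  rw [add_zero] at h1
  refine tendsto_of_tendsto_of_tendsto_of_le_of_le' tendsto_const_nhds h1
    (Eventually.of_forall fun _ => bot_le) ?_
  filter_upwards [hf.eventually_memLp_line, hf'.eventually_memLp_line] with h hh hh'
  refine (eLpNorm_congr_ae (Eventually.of_forall fun x => ?_)).trans_le
    (eLpNorm_add_le (hh.sub hg.1).1 (hh'.sub hg'.1).1 (by norm_num))
  simp only [Pi.add_apply]
  ring

theorem HasBoundaryData.const_mul (hg : HasBoundaryData f g) (c : ℂ) :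
    HasBoundaryData (fun ζ => c * f ζ) fun x => c * g x := by
  refine ⟨hg.1.const_mul c, ?_⟩
  have h1 := ENNReal.Tendsto.const_mul (a := ‖c‖ₑ) hg.2 (Or.inr enorm_ne_top)
  rw [mul_zero] at h1
  refine h1.congr fun h => ?_
  rw [← eLpNorm_const_smul]
  congr 1 with x
  simp [mul_sub]

theorem HasBoundaryData.congr (hg : HasBoundaryData f g)
    (h : ∀ ζ : ℂ, 0 < ζ.im → f ζ = f' ζ) : HasBoundaryData f' g := by
  refine ⟨hg.1, hg.2.congr' ?_⟩
  filter_upwards [self_mem_nhdsWithin] with y hy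
  have hy : 0 < y := hy
  congr 1 with x
  rw [h _ (by simpa using hy)]

end Linear

/-! ### The reproducing kernel -/

section Kernel
variable {z : ℂ}

theorem pKernel_eq (z ζ : ℂ) : pKernel z ζ = Complex.I * (ζ - (starRingEnd ℂ) z)⁻¹ :=
  div_eq_mul_inv _ _

theorem memHardy_pKernel (hz : 0 < z.im) : MemHardy (pKernel z) := by
  have hw : ((starRingEnd ℂ) z).im < 0 := by simpa using hz
  have hm := memLp_inv_ofReal_sub hw.ne
  have h1 : MemHardy fun ζ => (ζ - (starRingEnd ℂ) z)⁻¹ := by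
    refine ⟨fun ζ hζ => ?_, (eLpNorm (fun x : ℝ => ((x : ℂ) - (starRingEnd ℂ) z)⁻¹) 2
      volume).toNNReal, fun y hy => ?_⟩
    · have hζ : 0 < ζ.im := hζ
      refine (DifferentiableAt.inv (by fun_prop) fun h0 => ?_).differentiableWithinAt
      rw [sub_eq_zero.mp h0] at hζ
      linarith
    · rw [ENNReal.coe_toNNReal hm.2.ne]
      refine eLpNorm_mono fun x => ?_
      simpa using norm_inv_line_le hw hy.le x
  have e : pKernel z = fun ζ => Complex.I * (ζ - (starRingEnd ℂ) z)⁻¹ := funext (pKernel_eq z)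
  rw [e]
  exact h1.const_mul _

theorem hasBoundaryData_pKernel (hz : 0 < z.im) :
    HasBoundaryData (pKernel z) fun x : ℝ => pKernel z x := by
  have hw : ((starRingEnd ℂ) z).im < 0 := by simpa using hz
  have hm := memLp_inv_ofReal_sub hw.ne
  have h1 : HasBoundaryData (fun ζ => (ζ - (starRingEnd ℂ) z)⁻¹)
      fun x : ℝ => ((x : ℂ) - (starRingEnd ℂ) z)⁻¹ := by
    refine ⟨hm, ?_⟩
    set E := eLpNorm (fun x : ℝ => ((x : ℂ) - (starRingEnd ℂ) z)⁻¹) 2 volume with hE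
    -- By the resolvent identity the kernels at heights `h` and `0` differ by at most `h / Im z`
    -- times the latter.
    have hlim : Tendsto (fun h : ℝ => ‖((h / z.im : ℝ) : ℂ)‖ₑ * E) (𝓝[>] 0) (𝓝 0) := by
      have h2 : Tendsto (fun h : ℝ => ‖((h / z.im : ℝ) : ℂ)‖ₑ) (𝓝 0) (𝓝 0) := by
        have : Continuous fun h : ℝ => ‖((h / z.im : ℝ) : ℂ)‖ₑ := by fun_prop
        simpa using this.tendsto 0
      have h3 := ENNReal.Tendsto.mul_const (b := E) h2 (Or.inr hm.2.ne)
      rw [zero_mul] at h3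
      exact h3.mono_left nhdsWithin_le_nhds
    refine tendsto_of_tendsto_of_tendsto_of_le_of_le' tendsto_const_nhds hlim
      (Eventually.of_forall fun _ => bot_le) ?_
    filter_upwards [self_mem_nhdsWithin] with h hh
    have hh : 0 < h := hh
    rw [hE, ← eLpNorm_const_smul]
    refine eLpNorm_mono fun x => ?_
    have k1 : (x : ℂ) - (starRingEnd ℂ) z ≠ 0 := ofReal_sub_ne_zero hw.ne x
    have k0 : z.im ≤ ‖(x : ℂ) + h * Complex.I - (starRingEnd ℂ) z‖ := by
      have := (le_abs_self _).trans
        (Complex.abs_im_le_norm ((x : ℂ) + h * Complex.I - (starRingEnd ℂ) z))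
      simp only [Complex.sub_im, Complex.add_im, Complex.ofReal_im, Complex.mul_im,
        Complex.ofReal_re, Complex.I_im, Complex.I_re, Complex.conj_im] at this
      linarith
    have k2 : (x : ℂ) + h * Complex.I - (starRingEnd ℂ) z ≠ 0 :=
      norm_pos_iff.mp (hz.trans_le k0)
    have e : ((x : ℂ) + h * Complex.I - (starRingEnd ℂ) z)⁻¹ - ((x : ℂ) - (starRingEnd ℂ) z)⁻¹
        = -(h * Complex.I) * ((x : ℂ) + h * Complex.I - (starRingEnd ℂ) z)⁻¹
          * ((x : ℂ) - (starRingEnd ℂ) z)⁻¹ := by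
      field_simp
      ring
    rw [e, Pi.smul_apply, smul_eq_mul, norm_mul, norm_mul ((h / z.im : ℝ) : ℂ)]
    refine mul_le_mul_of_nonneg_right ?_ (norm_nonneg _)
    rw [norm_mul, norm_neg, norm_mul, Complex.norm_I, mul_one, Complex.norm_real,
      Complex.norm_real, norm_div, div_eq_mul_inv, norm_inv _, Real.norm_of_nonneg hz.le]
    exact mul_le_mul_of_nonneg_left (inv_anti₀ hz k0) (norm_nonneg h)
  have h2 := h1.const_mul Complex.I
  have e : pKernel z = fun ζ => Complex.I * (ζ - (starRingEnd ℂ) z)⁻¹ := funext (pKernel_eq z)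
  rw [e]
  exact h2

/-- `p_z` is the reproducing kernel of the Hardy space. -/
theorem MemHardy.integral_boundary_mul_conj_pKernel {f : ℂ → ℂ} {g : ℝ → ℂ} (hf : MemHardy f)
    (hg : HasBoundaryData f g) (hz : 0 < z.im) :
    ∫ x : ℝ, g x * (starRingEnd ℂ) (pKernel z x) = 2 * Real.pi * f z := by
  have h1 := hf.integral_boundary_mul_inv hg hz
  have e : ∀ x : ℝ, g x * (starRingEnd ℂ) (pKernel z x)
      = -Complex.I * (g x * ((x : ℂ) - z)⁻¹) := by
    intro x
    rw [pKernel_eq, map_mul, map_inv₀, map_sub, Complex.conj_I, Complex.conj_ofReal,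
      Complex.conj_conj]
    ring
  simp_rw [e]
  rw [integral_const_mul, h1]
  linear_combination (-(2 * Real.pi * f z : ℂ)) * Complex.I_sq

end Kernel

/-! ### Inverting the singular integral equation -/

section Cauchy
variable {u v : ℝ → ℂ}

theorem cauchyTransform_congr (h : u =ᵐ[intervalMeasure] v) :
    cauchyTransform u = cauchyTransform v := by
  ext ζ
  unfold cauchyTransform
  congr 1
  refine integral_congr_ae ?_
  filter_upwards [h] with y hy
  rw [hy]

theorem integrable_div_sub (hu : MemLp u 2 intervalMeasure) {ζ : ℂ} (hζ : 0 < ζ.im) :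
    Integrable (fun y : ℝ => u y / (ζ - y)) intervalMeasure := by
  simp_rw [div_eq_mul_inv]
  refine (integrable_of_memLp_interval hu).mul_bdd (c := (1 + 1 / ζ.im) * ‖ζ⁻¹‖)
    (Measurable.aestronglyMeasurable (by fun_prop)) ?_
  filter_upwards [ae_intervalMeasure_abs_lt] with y hy using norm_inv_sub_le hζ le_rfl hy

theorem cauchyTransform_add (hu : MemLp u 2 intervalMeasure) (hv : MemLp v 2 intervalMeasure)
    {ζ : ℂ} (hζ : 0 < ζ.im) :
    cauchyTransform u ζ + cauchyTransform v ζ = cauchyTransform (fun y => u y + v y) ζ := by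
  unfold cauchyTransform
  rw [← mul_add, ← integral_add (integrable_div_sub hu hζ) (integrable_div_sub hv hζ)]
  simp_rw [add_div]

theorem cauchyTransform_const_mul (c : ℂ) (ζ : ℂ) :
    c * cauchyTransform u ζ = cauchyTransform (fun y => c * u y) ζ := by
  unfold cauchyTransform
  simp_rw [mul_div_assoc]
  rw [integral_const_mul]
  ring

theorem l2Norm_boundary_cauchyTransform_le (hu : MemLp u 2 intervalMeasure) {G : ℝ → ℂ}
    (hG : HasBoundaryData (cauchyTransform u) G) :
    l2Norm volume G ≤ l2Norm intervalMeasure u := by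
  refine le_of_tendsto (tendsto_l2Norm (memHardy_cauchyTransform hu).eventually_memLp_line
    hG.1 hG.2) ?_
  filter_upwards [self_mem_nhdsWithin] with h hh using l2Norm_cauchyTransform_line_le hu hh

/-- The compression to `L²(-1, 1)` of the projection onto the Hardy space, as a function. -/
noncomputable def compressedProjectionFun (U : Lp ℂ 2 intervalMeasure) :
    Lp ℂ 2 intervalMeasure :=
  ((memHardy_cauchyTransform (Lp.memLp U)).hasBoundaryData.1.mono_measure
    intervalMeasure_le).toLp _

/-- `boundaryData` is a choice; a.e. uniqueness lets any representative and any boundary function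
replace it, which is how linearity is checked. -/
theorem compressedProjectionFun_eq (hu : MemLp u 2 intervalMeasure) {G : ℝ → ℂ}
    (hG : HasBoundaryData (cauchyTransform u) G) {U : Lp ℂ 2 intervalMeasure}
    (hU : U =ᵐ[intervalMeasure] u) :
    compressedProjectionFun U = (hG.1.mono_measure intervalMeasure_le).toLp G := by
  unfold compressedProjectionFun
  rw [MemLp.toLp_eq_toLp_iff]
  have h1 := (memHardy_cauchyTransform (Lp.memLp U)).hasBoundaryData
  rw [cauchyTransform_congr hU] at h1 ⊢
  exact ae_mono intervalMeasure_le (h1.ae_eq (memHardy_cauchyTransform hu) hG)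

/-- The compression to `L²(-1, 1)` of the projection onto the Hardy space. -/
noncomputable def compressedProjection :
    Lp ℂ 2 intervalMeasure →L[ℂ] Lp ℂ 2 intervalMeasure :=
  LinearMap.mkContinuous
    { toFun := compressedProjectionFun
      map_add' := fun U V => by
        have hU := Lp.memLp U
        have hV := Lp.memLp V
        have FU := memHardy_cauchyTransform hU
        have FV := memHardy_cauchyTransform hV
        rw [compressedProjectionFun_eq (hU.add hV)
          ((FU.hasBoundaryData.add FU FV FV.hasBoundaryData).congr
            fun ζ hζ => cauchyTransform_add hU hV hζ) (Lp.coeFn_add U V)]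
        exact MemLp.toLp_add (FU.hasBoundaryData.1.mono_measure intervalMeasure_le)
          (FV.hasBoundaryData.1.mono_measure intervalMeasure_le)
      map_smul' := fun c U => by
        have hU := Lp.memLp U
        have FU := memHardy_cauchyTransform hU
        rw [compressedProjectionFun_eq (hU.const_mul c)
          ((FU.hasBoundaryData.const_mul c).congr
            fun ζ _ => cauchyTransform_const_mul c ζ) (Lp.coeFn_smul c U)]
        exact MemLp.toLp_const_smul c (FU.hasBoundaryData.1.mono_measure intervalMeasure_le) }
    1 fun U => by
      have hU := Lp.memLp U
      have FU := memHardy_cauchyTransform hU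
      rw [one_mul]
      refine (Lp.norm_toLp _ (FU.hasBoundaryData.1.mono_measure intervalMeasure_le)).trans_le ?_
      exact (l2Norm_intervalMeasure_le FU.hasBoundaryData.1).trans
        ((l2Norm_boundary_cauchyTransform_le hU FU.hasBoundaryData).trans_eq (Lp.norm_def U).symm)

theorem compressedProjection_apply (U : Lp ℂ 2 intervalMeasure) :
    compressedProjection U = compressedProjectionFun U := rfl

/-- The adjoint relation, applied to the Cauchy transform of `U` itself, turns this pairing into the
squared norm of its boundary function on `ℝ`. -/
theorem re_inner_compressedProjection_nonneg (U : Lp ℂ 2 intervalMeasure) :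
    0 ≤ (inner ℂ (compressedProjection U) U).re := by
  have hU := Lp.memLp U
  have FU := memHardy_cauchyTransform hU
  have h1 := integral_boundary_mul_conj_cauchyTransform hU FU FU.hasBoundaryData
    FU.hasBoundaryData
  rw [integral_mul_conj_self FU.hasBoundaryData.1, ← inner_toLp_eq_integral
    (FU.hasBoundaryData.1.mono_measure intervalMeasure_le) hU, Lp.toLp_coeFn] at h1
  have h2 : compressedProjection U
    = (FU.hasBoundaryData.1.mono_measure intervalMeasure_le).toLp _ := rfl
  have h3 := inner_re_symm (𝕜 := ℂ) (compressedProjection U) U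
  rw [h2, ← h1] at h3
  rw [h2]
  refine le_of_le_of_eq ?_ h3.symm
  simp only [RCLike.re_to_complex, Complex.ofReal_re]
  positivity

/-- The operator of the singular integral equation. -/
noncomputable def singularOperator (ε : ℝ) :
    Lp ℂ 2 intervalMeasure →L[ℂ] Lp ℂ 2 intervalMeasure :=
  compressedProjection + ((ε ^ 2 : ℝ) : ℂ) • ContinuousLinearMap.id ℂ _

theorem singularOperator_apply (ε : ℝ) (U : Lp ℂ 2 intervalMeasure) :
    singularOperator ε U = compressedProjection U + ((ε ^ 2 : ℝ) : ℂ) • U := rfl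

/-- Coercivity with constant `ε²`: the compressed projection only adds a nonnegative real part. -/
theorem isUnit_singularOperator {ε : ℝ} (hε : 0 < ε) : IsUnit (singularOperator ε) := by
  have hε2 : 0 < ε ^ 2 := pow_pos hε 2
  refine ContinuousLinearMap.isUnit_of_forall_le_norm_inner_map _
    (c := (ε ^ 2).toNNReal) (Real.toNNReal_pos.mpr hε2) fun U => ?_
  refine le_trans ?_ (Complex.re_le_norm _)
  rw [Real.coe_toNNReal _ hε2.le, singularOperator_apply, inner_add_left, inner_smul_left, Complex.conj_ofReal, Complex.add_re,
    Complex.re_ofReal_mul, inner_self_eq_norm_sq_to_K]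
  have h1 := re_inner_compressedProjection_nonneg U
  have h2 : (((‖U‖ : ℝ) : ℂ) ^ 2).re = ‖U‖ ^ 2 := by
    rw [← Complex.ofReal_pow, Complex.ofReal_re]
  rw [show (RCLike.ofReal ‖U‖ : ℂ) = ((‖U‖ : ℝ) : ℂ) from rfl, h2]
  linarith

/-- The jump relation removes the principal value: it exists a.e. for every `u` in `L²`, and `(Ku +
u) / 2` equals `G`. -/
theorem solvesSingularEquation_iff {ε : ℝ} {z : ℂ} (hu : MemLp u 2 intervalMeasure) {G : ℝ → ℂ}
    (hG : HasBoundaryData (cauchyTransform u) G) :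
    SolvesSingularEquation ε z u ↔
      ∀ᵐ x : ℝ ∂intervalMeasure, G x + (ε : ℂ) ^ 2 * u x = pKernel z x := by
  have hpi : (Real.pi : ℂ) ≠ 0 := Complex.ofReal_ne_zero.mpr Real.pi_ne_zero
  have e : ∀ x : ℝ, (1 / 2 : ℂ) * (Complex.I / (Real.pi : ℂ) *
      (2 * Real.pi / Complex.I * (G x - u x / 2)) + u x) = G x := by
    intro x
    field_simp
    ring
  have hpv := ae_hasPrincipalValue hu hG
  constructor
  · rintro ⟨_, h⟩
    filter_upwards [h, hpv] with x ⟨l, hl, hx⟩ hx2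
    rw [tendsto_nhds_unique hl hx2, e] at hx
    exact hx
  · intro h
    refine ⟨hu, ?_⟩
    filter_upwards [h, hpv] with x hx hx2
    exact ⟨_, hx2, by rw [e, hx]⟩

theorem memLp_pKernel {z : ℂ} (hz : 0 < z.im) :
    MemLp (fun x : ℝ => pKernel z x) 2 intervalMeasure :=
  (hasBoundaryData_pKernel hz).1.mono_measure intervalMeasure_le

theorem solvesSingularEquation_iff_operator {ε : ℝ} {z : ℂ} (hz : 0 < z.im)
    (hu : MemLp u 2 intervalMeasure) :
    SolvesSingularEquation ε z u ↔
      singularOperator ε (hu.toLp u) = (memLp_pKernel hz).toLp _ := by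
  have hG := (memHardy_cauchyTransform hu).hasBoundaryData
  have hG' := hG.1.mono_measure intervalMeasure_le
  have hc := hu.const_mul ((ε ^ 2 : ℝ) : ℂ)
  have e : singularOperator ε (hu.toLp u) = (hG'.add hc).toLp _ := by
    rw [MemLp.toLp_add hG' hc, singularOperator_apply, compressedProjection_apply,
      compressedProjectionFun_eq hu hG hu.coeFn_toLp]
    rfl
  rw [solvesSingularEquation_iff hu hG, e, MemLp.toLp_eq_toLp_iff]
  simp only [Complex.ofReal_pow]
  rfl

theorem exists_solvesSingularEquation {ε : ℝ} (hε : 0 < ε) {z : ℂ} (hz : 0 < z.im) :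
    ∃ u : ℝ → ℂ, SolvesSingularEquation ε z u := by
  obtain ⟨A, hA⟩ := isUnit_singularOperator hε
  set U := (A⁻¹).val ((memLp_pKernel hz).toLp _) with hU
  refine ⟨U, (solvesSingularEquation_iff_operator hz (Lp.memLp U)).mpr ?_⟩
  rw [Lp.toLp_coeFn, ← hA, hU, ← mul_apply_eq_comp, Units.mul_inv]
  rfl

theorem SolvesSingularEquation.ae_eq {ε : ℝ} (hε : 0 < ε) {z : ℂ} (hz : 0 < z.im)
    (hu : SolvesSingularEquation ε z u) (hv : SolvesSingularEquation ε z v) :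
    u =ᵐ[intervalMeasure] v := by
  obtain ⟨A, hA⟩ := isUnit_singularOperator hε
  have h1 := (solvesSingularEquation_iff_operator hz hu.1).mp hu
  have h2 := (solvesSingularEquation_iff_operator hz hv.1).mp hv
  rw [← h2, ← hA] at h1
  have h3 := congrArg (A⁻¹).val h1
  rw [← mul_apply_eq_comp, ← mul_apply_eq_comp, Units.inv_mul] at h3
  exact (MemLp.toLp_eq_toLp_iff hu.1 hv.1).mp h3

/-- If `u` vanished then so would `G`, and the equation would make the zero-free `p_z` vanish a.e.
on a set of positive measure. -/
theorem SolvesSingularEquation.normL2Interval_pos {ε : ℝ} {z : ℂ} (hz : 0 < z.im)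
    (hu : SolvesSingularEquation ε z u) : 0 < normL2Interval u := by
  have hG := (memHardy_cauchyTransform hu.1).hasBoundaryData
  refine lt_of_le_of_ne ENNReal.toReal_nonneg fun h0 => ?_
  have hu0 : u =ᵐ[intervalMeasure] 0 := (eLpNorm_eq_zero_iff hu.1.1 (by norm_num)).mp
    (((ENNReal.toReal_eq_zero_iff _).mp h0.symm).resolve_right hu.1.2.ne)
  have hG0 : boundaryData (cauchyTransform u) =ᵐ[volume] 0 := by
    refine (eLpNorm_eq_zero_iff hG.1.1 (by norm_num : (2 : ENNReal) ≠ 0)).mp ?_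
    have h1 := l2Norm_boundary_cauchyTransform_le hu.1 hG
    rw [show l2Norm intervalMeasure u = 0 from h0.symm] at h1
    exact ((ENNReal.toReal_eq_zero_iff _).mp (le_antisymm h1 l2Norm_nonneg)).resolve_right
      hG.1.2.ne
  have hF : ∀ᵐ _ : ℝ ∂intervalMeasure, False := by
    filter_upwards [hu0, ae_mono intervalMeasure_le hG0,
      (solvesSingularEquation_iff hu.1 hG).mp hu] with x h1 h2 h3
    have hw : ((starRingEnd ℂ) z).im ≠ 0 := by simpa using hz.ne'
    rw [h1, h2, Pi.zero_apply, mul_zero, add_zero, pKernel_eq] at h3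
    exact mul_ne_zero Complex.I_ne_zero (inv_ne_zero (ofReal_sub_ne_zero hw x)) h3.symm
  rw [ae_iff, intervalMeasure] at hF
  norm_num at hF

end Cauchy

/-! ### The extension and the pointwise bound -/

section Extremal
variable {u : ℝ → ℂ} {ε : ℝ} {z : ℂ}

theorem solutionExtension_eq (ε : ℝ) (z : ℂ) (u : ℝ → ℂ) (ζ : ℂ) :
    solutionExtension ε z u ζ = ((ε : ℂ) ^ 2)⁻¹ * (pKernel z ζ + -1 * cauchyTransform u ζ) := by
  unfold solutionExtension cauchyTransform
  ring

theorem memHardy_solutionExtension (hz : 0 < z.im) (hu : MemLp u 2 intervalMeasure) :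
    MemHardy (solutionExtension ε z u) := by
  rw [funext (solutionExtension_eq ε z u)]
  exact ((memHardy_pKernel hz).add ((memHardy_cauchyTransform hu).const_mul _)).const_mul _

theorem hasBoundaryData_solutionExtension (hz : 0 < z.im) (hu : MemLp u 2 intervalMeasure)
    {G : ℝ → ℂ} (hG : HasBoundaryData (cauchyTransform u) G) :
    HasBoundaryData (solutionExtension ε z u)
      fun x => ((ε : ℂ) ^ 2)⁻¹ * (pKernel z x + -1 * G x) := by
  rw [funext (solutionExtension_eq ε z u)]
  exact ((hasBoundaryData_pKernel hz).add (memHardy_pKernel hz)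
    ((memHardy_cauchyTransform hu).const_mul _) (hG.const_mul _)).const_mul _

/-- The point evaluation at `z` in terms of the pairings with the solution on the line and on the
interval. -/
theorem MemHardy.two_pi_mul_eq (hε : 0 < ε) (hz : 0 < z.im) (hu : MemLp u 2 intervalMeasure)
    {f : ℂ → ℂ} {g V : ℝ → ℂ} (hf : MemHardy f) (hg : HasBoundaryData f g)
    (hV : HasBoundaryData (solutionExtension ε z u) V) :
    2 * Real.pi * f z = (ε : ℂ) ^ 2 * (∫ x : ℝ, g x * (starRingEnd ℂ) (V x))
      + ∫ x : ℝ, g x * (starRingEnd ℂ) (u x) ∂intervalMeasure := by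
  have hεc : (ε : ℂ) ^ 2 ≠ 0 := pow_ne_zero 2 (Complex.ofReal_ne_zero.mpr hε.ne')
  have hG := (memHardy_cauchyTransform hu).hasBoundaryData
  -- On the line `p_z = ε² V + G`; the reproducing property handles the left side and the adjoint
  -- relation the term with `G`.
  rw [← hf.integral_boundary_mul_conj_pKernel hg hz,
    ← integral_boundary_mul_conj_cauchyTransform hu hf hg hG, ← integral_const_mul,
    ← integral_add ((integrable_mul_of_memLp hg.1 (memLp_conj hV.1)).const_mul _)
      (integrable_mul_of_memLp hg.1 (memLp_conj hG.1))]
  refine integral_congr_ae ?_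
  filter_upwards [hV.ae_eq (memHardy_solutionExtension hz hu)
    (hasBoundaryData_solutionExtension hz hu hG)] with x hx
  rw [hx]
  simp only [map_mul, map_inv₀, map_pow, Complex.conj_ofReal, map_add, map_neg, map_one]
  linear_combination -(g x * ((starRingEnd ℂ) (pKernel z x)
    - (starRingEnd ℂ) (boundaryData (cauchyTransform u) x))) * mul_inv_cancel₀ hεc

/-- The equation says that the extension has boundary values `u` on the interval, so representing
its own value at `z` gives two squared norms. -/
theorem SolvesSingularEquation.two_pi_mul_solutionExtension (hε : 0 < ε) (hz : 0 < z.im)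
    (hu : SolvesSingularEquation ε z u) {V : ℝ → ℂ}
    (hV : HasBoundaryData (solutionExtension ε z u) V) :
    2 * Real.pi * solutionExtension ε z u z
      = ((ε ^ 2 * l2Norm volume V ^ 2 + l2Norm intervalMeasure u ^ 2 : ℝ) : ℂ) := by
  have hεc : (ε : ℂ) ^ 2 ≠ 0 := pow_ne_zero 2 (Complex.ofReal_ne_zero.mpr hε.ne')
  have hU := memHardy_solutionExtension (ε := ε) hz hu.1
  have hG := (memHardy_cauchyTransform hu.1).hasBoundaryData
  have hVu : V =ᵐ[intervalMeasure] u := by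
    filter_upwards [ae_mono intervalMeasure_le
      (hV.ae_eq hU (hasBoundaryData_solutionExtension hz hu.1 hG)),
      (solvesSingularEquation_iff hu.1 hG).mp hu] with x h1 h2
    rw [h1, ← h2, neg_one_mul, add_assoc, add_comm, add_assoc, neg_add_cancel, add_zero,
      inv_mul_cancel_left₀ hεc]
  rw [hU.two_pi_mul_eq hε hz hu.1 hV hV, integral_mul_conj_self hV.1]
  have h1 : ∫ x : ℝ, V x * (starRingEnd ℂ) (u x) ∂intervalMeasure
      = ∫ x : ℝ, u x * (starRingEnd ℂ) (u x) ∂intervalMeasure := by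
    refine integral_congr_ae ?_
    filter_upwards [hVu] with x hx
    rw [hx]
  rw [h1, integral_mul_conj_self hu.1]
  push_cast
  ring

end Extremal

theorem theorem6p1 (z : ℂ) (hz : 0 < z.im) (ε : ℝ) (hε : 0 < ε) :
    -- the integral equation has a solution in `L²(-1, 1)`, unique up to null sets
    (∃ u : ℝ → ℂ, SolvesSingularEquation ε z u) ∧
    (∀ u v : ℝ → ℂ, SolvesSingularEquation ε z u → SolvesSingularEquation ε z v →
      u =ᵐ[intervalMeasure] v) ∧
    -- its value at `z` is real, and it controls every admissible `f` at `z`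
    ∀ u : ℝ → ℂ, SolvesSingularEquation ε z u →
      0 < normL2Interval u ∧
      (solutionExtension ε z u z).im = 0 ∧
      ∀ f : ℂ → ℂ, MemHardy f → hardyNorm f ≤ 1 → normL2Interval (boundaryData f) ≤ ε →
        ‖f z‖ ≤ 3 / 2 * ε * (solutionExtension ε z u z).re / normL2Interval u := by
  refine ⟨exists_solvesSingularEquation hε hz, fun u v hu hv => hu.ae_eq hε hz hv,
    fun u hu => ?_⟩
  have hpos := hu.normL2Interval_pos hz
  have hpi := Real.pi_pos
  have hV := (memHardy_solutionExtension (ε := ε) hz hu.1).hasBoundaryData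
  have hval := hu.two_pi_mul_solutionExtension hε hz hV
  set a := l2Norm volume (boundaryData (solutionExtension ε z u)) with ha
  have hval' : solutionExtension ε z u z
      = (((ε ^ 2 * a ^ 2 + l2Norm intervalMeasure u ^ 2) / (2 * Real.pi) : ℝ) : ℂ) := by
    have : (Real.pi : ℂ) ≠ 0 := Complex.ofReal_ne_zero.mpr hpi.ne'
    rw [Complex.ofReal_div, ← hval]
    push_cast
    field_simp
  refine ⟨hpos, by rw [hval', Complex.ofReal_im], fun f hf hf1 hf2 => ?_⟩
  have hg := hf.hasBoundaryData
  set b := normL2Interval u with hb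
  have hbu : l2Norm intervalMeasure u = b := rfl
  have h1 := hf.two_pi_mul_eq hε hz hu.1 hg hV
  have ha0 : 0 ≤ a := l2Norm_nonneg
  have h2 : ‖∫ x : ℝ, boundaryData f x *
      (starRingEnd ℂ) (boundaryData (solutionExtension ε z u) x)‖ ≤ 1 * a := by
    refine (norm_integral_mul_le hg.1 (memLp_conj hV.1)).trans ?_
    rw [l2Norm_conj]
    exact mul_le_mul_of_nonneg_right hf1 ha0
  have h3 : ‖∫ x : ℝ, boundaryData f x * (starRingEnd ℂ) (u x) ∂intervalMeasure‖ ≤ ε * b := by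
    refine (norm_integral_mul_le (hg.1.mono_measure intervalMeasure_le)
      (memLp_conj hu.1)).trans ?_
    rw [l2Norm_conj]
    exact mul_le_mul_of_nonneg_right hf2 hpos.le
  have h4 : 2 * Real.pi * ‖f z‖ ≤ ε ^ 2 * a + ε * b := by
    have e : ‖(2 * Real.pi * f z : ℂ)‖ = 2 * Real.pi * ‖f z‖ := by
      rw [norm_mul, norm_mul, Complex.norm_ofNat, Complex.norm_real, Real.norm_of_nonneg hpi.le]
    rw [← e, h1]
    refine (norm_add_le _ _).trans (add_le_add ?_ h3)
    rw [norm_mul, norm_pow, Complex.norm_real, Real.norm_of_nonneg hε.le]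
    have := mul_le_mul_of_nonneg_left h2 (sq_nonneg ε)
    linarith
  rw [hval', Complex.ofReal_re, hbu, le_div_iff₀ hpos, mul_div_assoc', le_div_iff₀ (by positivity)]
  have h5 : 2 * Real.pi * ‖f z‖ * b ≤ (ε ^ 2 * a + ε * b) * b :=
    mul_le_mul_of_nonneg_right h4 hpos.le
  -- With `t = εa`, the slack `3/2 (t² + b²) - (tb + b²)` equals `(t - b)² / 2 + t²`.
  nlinarith [mul_nonneg hε.le (sq_nonneg (ε * a - b)), mul_nonneg hε.le (sq_nonneg (ε * a))]
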